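/- For a finite hypergraph $\mathcal H$ (with nonempty hyperedges), ${\rm KG}(\mathcal H)$ is the graph whose vertices are the hyperedges of $\mathcal H$, two being adjacent if they are disjoint. For $X\in\{-1,0,1\}^N$ let $alt(X)$ be the length of a longest subsequence of nonzero terms of $X$ in which any two consecutive terms are different. For a linear ordering $\sigma=(v_1,\dots,v_N)$ of $V(\mathcal H)$ let $alt_\sigma(\mathcal H)$ be the largest value of $alt(X)$ over all $X\in\{-1,0,1\}^N$ such that neither $\{v_j: X_j=1\}$ nor $\{v_j: X_j=-1\}$ contains a hyperedge of $\mathcal H$, and let $alt(\mathcal H)=\min_\sigma alt_\sigma(\mathcal H)$. The altermatic number of a graph $G$ is $$\zeta(G)=\max\{|V(\mathcal H)|-alt(\mathcal H)\},$$ the maximum being over all finite hypergraphs $\mathcal H$ such that ${\rm KG}(\mathcal H)$ and $G$ are homomorphically equivalent, i.e. there are graph homomorphisms ${\rm KG}(\mathcal H)\to G$ and $G\to{\rm KG}(\mathcal H)$. Let ${\rm KG}(K_{m,n},rK_2)$ be the graph whose vertices are the subgraphs of the complete bipartite graph $K_{m,n}$ isomorphic to $rK_2$ ($r$ disjoint copies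 of $K_2$), two being adjacent if they are edge-disjoint (this is the permutation graph). **Statement.** For every positive integer $r$ there is an integer $m_0$ such that for all integers $m,n$ with $m\geq m_0$ and $m\geq n\geq r$, $$\chi({\rm KG}(K_{m,n},rK_2))=\zeta({\rm KG}(K_{m,n},rK_2))=m(n-r+1).$$ -/

import Mathlib

/-- Two graphs are homomorphically equivalent if there are homomorphisms in both directions. -/
def HomEquivalent {V W : Type*} (G : SimpleGraph V) (H : SimpleGraph W) : Prop :=
  Nonempty (G →g H) ∧ Nonempty (H →g G)

/-- The general Kneser graph `KG(H)` of a hypergraph `H`: its vertices are the hyperedges of `H`,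
two of them being adjacent if they are disjoint. (The condition `e ≠ f` is automatic if
hyperedges are nonempty.) -/
def kneserGraph {α : Type*} (H : Hypergraph α) : SimpleGraph H.edgeSet where
  Adj e f := e ≠ f ∧ Disjoint (e : Set α) (f : Set α)
  symm := ⟨fun _ _ h => ⟨h.1.symm, h.2.symm⟩⟩
  loopless := ⟨fun _ h => h.1 rfl⟩

/-- The alternation number of a sign vector `X ∈ {-1, 0, 1}ⁿ`: the maximum length of a subsequence
of nonzero terms of `X` any two consecutive terms of which are different. -/
noncomputable def alternationNumber {n : ℕ} (X : Fin n → SignType) : ℕ :=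
  sSup {k | ∃ l : List SignType, l.Sublist (List.ofFn X) ∧ 0 ∉ l ∧ l.IsChain (· ≠ ·) ∧
    l.length = k}

/-- The set of vertices that receive the sign `s` when the entries of the sign vector `X` are
placed on the vertices of `H` along the linear ordering `σ`. For `s = 1` and `s = -1` these are
the sets `X⁺` and `X⁻` with respect to `σ`. -/
def signClass {α : Type*} (H : Hypergraph α) {n : ℕ} (σ : Fin n ≃ H.vertexSet)
    (X : Fin n → SignType) (s : SignType) : Set α :=
  {v | ∃ j, X j = s ∧ (σ j : α) = v}

/-- `alt_σ(H)`: the largest alternation number of a sign vector `X` such that neither `X⁺` nor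
`X⁻` (with respect to the ordering `σ`) contains a hyperedge of `H`. -/
noncomputable def altOrder {α : Type*} (H : Hypergraph α) {n : ℕ} (σ : Fin n ≃ H.vertexSet) : ℕ :=
  sSup {k | ∃ X : Fin n → SignType,
    (∀ e ∈ H.edgeSet, ¬ e ⊆ signClass H σ X 1 ∧ ¬ e ⊆ signClass H σ X (-1)) ∧
    alternationNumber X = k}

/-- `alt(H)`: the minimum of `alt_σ(H)` over all linear orderings `σ` of the vertex set of the
(finite) hypergraph `H`. -/
noncomputable def altHypergraph {α : Type*} (H : Hypergraph α) : ℕ :=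
  ⨅ σ : Fin H.vertexSet.ncard ≃ H.vertexSet, altOrder H σ

/-- The altermatic number `ζ(G)`: the maximum of `|V(H)| - alt(H)` over all finite hypergraphs `H`
with nonempty hyperedges such that `KG(H)` is homomorphically equivalent to `G`. It is written as
a supremum in `ℕ∞`; when that supremum is finite and positive, it is attained. -/
noncomputable def altermaticNumber {V : Type*} (G : SimpleGraph V) : ℕ∞ :=
  ⨆ (α : Type) (H : Hypergraph α) (_ : H.vertexSet.Finite) (_ : ∅ ∉ H.edgeSet)
    (_ : HomEquivalent (kneserGraph H) G), ((H.vertexSet.ncard - altHypergraph H : ℕ) : ℕ∞)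

/-- The graph `KG(G, F)`: its vertices are the subgraphs of `G` that are isomorphic to `F`, two of
them being adjacent if they are edge-disjoint. (The condition `A ≠ B` is automatic if `F` has an
edge.) -/
def subgraphKneserGraph {V W : Type*} (G : SimpleGraph V) (F : SimpleGraph W) :
    SimpleGraph {A : G.Subgraph // Nonempty (A.coe ≃g F)} where
  Adj A B := A ≠ B ∧ Disjoint A.1.edgeSet B.1.edgeSet
  symm := ⟨fun _ _ h => ⟨h.1.symm, h.2.symm⟩⟩
  loopless := ⟨fun _ h => h.1 rfl⟩

/-- The graph `r K₂`: `r` pairwise disjoint copies of the complete graph on two vertices. -/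
def copiesK2 (r : ℕ) : SimpleGraph (Fin r × Fin 2) where
  Adj x y := x.1 = y.1 ∧ x.2 ≠ y.2
  symm := ⟨fun _ _ h => ⟨h.1.symm, h.2.symm⟩⟩
  loopless := ⟨fun _ h => h.2 rfl⟩

/-! For the upper bound, the `r` disjoint edges of a copy of `rK₂` have `r` distinct ends on the
`n`-side, so one of them avoids a fixed set of `r - 1` vertices there; an edge with such an end
serves as the colour. That `ζ ≤ χ` holds for every graph is the Alishahi–Hajiabolhassan bound
(`le_altOrder_add_of_coloring`). It follows from the octahedral Tucker lemma, which is proved by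
counting flags of sign vectors modulo 2.

It remains to order the edges of `K_{m,n}`, seen as the cells of an `n × m` array, so that `alt(X) ≤
m(r - 1)` whenever neither sign class of `X` contains an `rK₂`. Keep only the entries of a longest
alternating subsequence: every sum over an interval of the order is then at most 1 in absolute value
(`exists_balanced`). By König's theorem the cells of each sign are covered by at most `R = r - 1`
rows and columns (`exists_cover_of_no_matching`). If both signs have the same cover, at most `mR`
cells are nonzero.

Otherwise, a line that covers only one sign should cost half as much as a line that covers both. The
array is therefore cut into quadrants: two opposite ones are read by rows, the other two by columns
(`cellKey`). A row that covers one sign only has at most `2R + 1` nonzero cells where the reading is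
by rows and about `m/2` elsewhere. The additive constants are paid for by reversing the direction in
every other line: if the covers differ in a column, almost every pair of consecutive rows that meets
this column in the part read by rows loses a cell (`palindromic_pair`), and likewise with rows and
columns exchanged. `BalancedArray.sum_abs_le` shows that for large `m` this outweighs the constants.
-/

/-! ### Octahedral Tucker lemma: flags of sign vectors modulo 2. -/

/-- The sum of `P` over all chains of nonzero sign vectors that are obtained from `Y` by deleting
one nonzero entry at a time, with `k` terms the largest of which is `Y`. -/
def flagSum {ι : Type*} [Fintype ι] [DecidableEq ι] :
    ℕ → (ι → SignType) → (Multiset (ι → SignType) → ZMod 2) → ZMod 2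
  | 0, _, P => P 0
  | k + 1, Y, P => ∑ i with Y i ≠ 0, flagSum k (Function.update Y i 0) (fun m => P (Y ::ₘ m))

/-- The coboundary modulo 2 of a function on multisets. -/
def coboundary {α : Type*} [DecidableEq α] (P : Multiset α → ZMod 2) (m : Multiset α) : ZMod 2 :=
  (m.map fun x => P (m.erase x)).sum

/-- The sign vector `X` is obtained from `Y` by replacing some entries by `0`. -/
def SignSub {ι : Type*} (X Y : ι → SignType) : Prop := ∀ i, X i ≠ 0 → X i = Y i

/-- The members of `m` are nonzero, pairwise comparable and below `Y`. -/
def IsFlag {ι : Type*} (m : Multiset (ι → SignType)) (Y : ι → SignType) : Prop :=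
  (∀ x ∈ m, x ≠ 0 ∧ SignSub x Y) ∧ ∀ x ∈ m, ∀ y ∈ m, SignSub x y ∨ SignSub y x

theorem SignSub.refl {ι : Type*} (X : ι → SignType) : SignSub X X := fun _ _ => rfl

theorem SignSub.trans {ι : Type*} {X Y Z : ι → SignType} (h : SignSub X Y) (h' : SignSub Y Z) :
    SignSub X Z := fun i hi => by
  have := h i hi
  rw [this] at hi ⊢
  exact h' i hi

theorem SignSub.update_zero {ι : Type*} [DecidableEq ι] (X : ι → SignType) (i : ι) :
    SignSub (Function.update X i 0) X := by
  intro j hj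
  by_cases h : j = i
  · subst h; simp at hj
  · simp [h]

theorem sum_sum_erase_symm_eq_zero {ι : Type*} [DecidableEq ι] (s : Finset ι) (f : ι → ι → ZMod 2)
    (hf : ∀ i j, f i j = f j i) : ∑ i ∈ s, ∑ j ∈ s.erase i, f i j = 0 := by
  rw [Finset.sum_sigma']
  refine Finset.sum_involution (fun p _ => ⟨p.2, p.1⟩) ?_ ?_ ?_ ?_
  · rintro ⟨i, j⟩ _
    simp only [hf j i]
    exact CharTwo.add_self_eq_zero _
  · rintro ⟨i, j⟩ hp _
    simp only [Finset.mem_sigma, Finset.mem_erase] at hp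
    intro h
    simp only [Sigma.mk.injEq] at h
    exact hp.2.1 h.1
  · rintro ⟨i, j⟩ hp
    simp only [Finset.mem_sigma, Finset.mem_erase] at hp ⊢
    exact ⟨hp.2.2, hp.2.1.symm, hp.1⟩
  · rintro ⟨i, j⟩ _
    rfl

theorem coboundary_cons {α : Type*} [DecidableEq α] (P : Multiset α → ZMod 2) (y : α)
    (m : Multiset α) :
    coboundary P (y ::ₘ m) = P m + coboundary (fun l => P (y ::ₘ l)) m := by
  simp only [coboundary, Multiset.map_cons, Multiset.sum_cons, Multiset.erase_cons_head]
  congr 2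
  refine Multiset.map_congr rfl fun x hx => ?_
  by_cases h : x = y
  · subst h
    rw [Multiset.erase_cons_head, Multiset.cons_erase hx]
  · rw [Multiset.erase_cons_tail _ (Ne.symm h)]

section Flag

variable {ι : Type*} [Fintype ι] [DecidableEq ι]

theorem flagSum_add (k : ℕ) (Y : ι → SignType) (P Q : Multiset (ι → SignType) → ZMod 2) :
    flagSum k Y (fun m => P m + Q m) = flagSum k Y P + flagSum k Y Q := by
  induction k generalizing Y P Q with
  | zero => rfl
  | succ k ih => simp only [flagSum, ih, Finset.sum_add_distrib]

theorem flagSum_neg (k : ℕ) (Y : ι → SignType) (P : Multiset (ι → SignType) → ZMod 2) :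
    flagSum k (-Y) P = flagSum k Y (fun m => P (m.map Neg.neg)) := by
  induction k generalizing Y P with
  | zero => rfl
  | succ k ih =>
    simp only [flagSum]
    have : ∀ i, Function.update (-Y) i 0 = -Function.update Y i 0 := by
      intro i; ext j
      by_cases h : j = i
      · subst h; simp
      · simp [h]
    simp only [this, ih, Multiset.map_cons]
    refine Finset.sum_congr ?_ fun _ _ => rfl
    ext i
    simp

theorem flagSum_congr (k : ℕ) (Y : ι → SignType) (P Q : Multiset (ι → SignType) → ZMod 2)
    (h : ∀ m, Multiset.card m = k → IsFlag m Y → P m = Q m) : flagSum k Y P = flagSum k Y Q := by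
  induction k generalizing Y P Q with
  | zero => exact h 0 rfl ⟨by simp, by simp⟩
  | succ k ih =>
    simp only [flagSum]
    refine Finset.sum_congr rfl fun i hi => ih _ _ _ fun m hm hf => h _ (by simp [hm]) ?_
    have hi : Y i ≠ 0 := by simpa using hi
    have hY : ∀ x ∈ m, SignSub x Y := fun x hx =>
      (hf.1 x hx).2.trans (SignSub.update_zero Y i)
    refine ⟨?_, ?_⟩
    · intro x hx
      rcases Multiset.mem_cons.1 hx with rfl | hx
      · exact ⟨fun h0 => hi (by simp [h0]), SignSub.refl _⟩
      · exact ⟨(hf.1 x hx).1, hY x hx⟩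
    · intro x hx' y hy'
      rcases Multiset.mem_cons.1 hx' with rfl | hx <;> rcases Multiset.mem_cons.1 hy' with rfl | hy
      · exact Or.inl (SignSub.refl _)
      · exact Or.inr (hY y hy)
      · exact Or.inl (hY x hx)
      · exact hf.2 x hx y hy

/-- Modulo 2 only the removal of the top member survives. Any other member lies between two vectors
that differ by deleting entries `i` and `j`, and the two orders of deletion cancel. -/
theorem flagSum_coboundary (k : ℕ) (Y : ι → SignType) (P : Multiset (ι → SignType) → ZMod 2) :
    flagSum (k + 1) Y (coboundary P) =
      ∑ i with Y i ≠ 0, flagSum k (Function.update Y i 0) P := by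
  induction k generalizing Y P with
  | zero => simp [flagSum, coboundary]
  | succ k ih =>
    rw [flagSum]
    simp only [coboundary_cons, flagSum_add, Finset.sum_add_distrib, ih]
    rw [add_eq_left]
    have : ∀ i, (Finset.univ.filter fun j => Function.update Y i 0 j ≠ 0) =
        (Finset.univ.filter fun j => Y j ≠ 0).erase i := by
      intro i; ext j
      by_cases h : j = i
      · subst h; simp
      · simp [h]
    simp only [this]
    refine sum_sum_erase_symm_eq_zero _ (fun i j => flagSum k
      (Function.update (Function.update Y i 0) j 0) fun l => P (Y ::ₘ l)) fun i j => ?_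
    by_cases h : i = j
    · subst h; rfl
    · rw [Function.update_comm h]

end Flag

/-- The sign vectors whose nonzero entries are the first `k` ones. -/
def initialSupport (N k : ℕ) : Finset (Fin N → SignType) :=
  Finset.univ.filter fun Y => ∀ i, Y i ≠ 0 ↔ (i : ℕ) < k

/-- This is the inductive step of Tucker's lemma: `hP` turns the contributions of `Y` and `-Y` into
a coboundary, so that only the facets of the half-sphere `Y e = 1` are counted. Interior facets
occur twice, and the boundary is the sphere one dimension lower. -/
theorem sum_flagSum_initialSupport_succ {N k : ℕ} (hk : k < N)
    (P : Multiset (Fin N → SignType) → ZMod 2)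
    (hP : ∀ (m : Multiset (Fin N → SignType)) Y, IsFlag m Y →
      coboundary P m = P m + P (m.map Neg.neg)) :
    ∑ Y ∈ initialSupport N (k + 1), flagSum (k + 1) Y P =
      ∑ Y ∈ initialSupport N k, flagSum k Y P := by
  set e : Fin N := ⟨k, hk⟩ with he
  set T := initialSupport N (k + 1) with hT
  set T₁ := T.filter fun Y => Y e = 1 with hT₁
  have memT : ∀ Y, Y ∈ T ↔ ∀ i, Y i ≠ 0 ↔ (i : ℕ) < k + 1 := by simp [hT, initialSupport]
  have hsplit : ∑ Y ∈ T, flagSum (k + 1) Y P =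
      ∑ Y ∈ T₁, flagSum (k + 1) Y P + ∑ Y ∈ T₁, flagSum (k + 1) (-Y) P := by
    rw [← Finset.sum_filter_add_sum_filter_not T fun Y => Y e = 1]
    congr 1
    refine Finset.sum_bij' (fun Y _ => -Y) (fun Y _ => -Y) ?_ ?_ ?_ ?_ ?_
    · intro Y hY
      simp only [Finset.mem_filter, memT, hT₁] at hY ⊢
      refine ⟨by simpa using hY.1, ?_⟩
      have h0 : Y e ≠ 0 := (hY.1 e).2 (by simp [he])
      have h1 := hY.2
      revert h0 h1
      simp only [Pi.neg_apply]
      generalize Y e = s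
      revert s; decide
    · intro Y hY
      simp only [Finset.mem_filter, memT, hT₁] at hY ⊢
      refine ⟨by simpa using hY.1, ?_⟩
      simp only [Pi.neg_apply, hY.2]
      decide
    · intro Y _; simp
    · intro Y _; simp
    · intro Y _; simp
  have hcob : ∀ Y, flagSum (k + 1) Y P + flagSum (k + 1) (-Y) P =
      ∑ i with Y i ≠ 0, flagSum k (Function.update Y i 0) P := by
    intro Y
    rw [← flagSum_coboundary, flagSum_neg, ← flagSum_add]
    exact flagSum_congr _ _ _ _ fun m _ hm => (hP m Y hm).symm
  rw [hsplit, ← Finset.sum_add_distrib]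
  simp only [hcob]
  have hsupp : ∀ Y ∈ T₁, (Finset.univ.filter fun i => Y i ≠ 0) =
      Finset.univ.filter fun i : Fin N => (i : ℕ) < k + 1 := by
    intro Y hY
    simp only [Finset.mem_filter, memT, hT₁] at hY
    ext i; simp [hY.1 i]
  rw [Finset.sum_congr rfl fun Y hY => Finset.sum_congr (hsupp Y hY) fun _ _ => rfl,
    Finset.sum_comm]
  rw [Finset.sum_eq_single_of_mem e (by simp [he])]
  · refine Finset.sum_bij' (fun Y _ => Function.update Y e 0) (fun Y _ => Function.update Y e 1)
      ?_ ?_ ?_ ?_ ?_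
    · intro Y hY
      simp only [Finset.mem_filter, memT, hT₁, initialSupport, Finset.mem_univ, true_and] at hY ⊢
      intro i
      by_cases h : i = e
      · subst h; simp [he]
      · have : (i : ℕ) ≠ k := fun h' => h (Fin.ext h')
        rw [Function.update_of_ne h, hY.1 i]; omega
    · intro Y hY
      simp only [Finset.mem_filter, memT, hT₁, initialSupport, Finset.mem_univ, true_and] at hY ⊢
      refine ⟨fun i => ?_, by simp⟩
      by_cases h : i = e
      · subst h; simp [he]
      · have : (i : ℕ) ≠ k := fun h' => h (Fin.ext h')
        rw [Function.update_of_ne h, hY i]; omega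
    · intro Y hY
      simp only [Finset.mem_filter, hT₁] at hY
      rw [Function.update_idem, ← hY.2, Function.update_eq_self]
    · intro Y hY
      simp only [Finset.mem_filter, initialSupport, Finset.mem_univ, true_and] at hY
      have : Y e = 0 := by
        by_contra h
        have := (hY e).1 h
        simp [he] at this
      rw [Function.update_idem, ← this, Function.update_eq_self]
    · intro Y _; rfl
  -- A facet that omits `i ≠ e` belongs to exactly two vectors of the half-sphere, which differ in
  -- the sign at `i`.
  · intro i hi hie
    refine Finset.sum_involution (fun Y _ => Function.update Y i (-Y i)) ?_ ?_ ?_ ?_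
    · intro Y _
      rw [Function.update_idem]
      exact CharTwo.add_self_eq_zero _
    · intro Y hY _ h
      simp only [Finset.mem_filter, memT, hT₁] at hY
      have h0 : Y i ≠ 0 := (hY.1 i).2 (by simpa using hi)
      have h1 := congrFun h i
      rw [Function.update_self] at h1
      revert h0 h1
      generalize Y i = s
      revert s; decide
    · intro Y hY
      simp only [Finset.mem_filter, memT, hT₁] at hY ⊢
      refine ⟨fun j => ?_, by rw [Function.update_of_ne (Ne.symm hie)]; exact hY.2⟩
      by_cases h : j = i
      · subst h
        rw [Function.update_self, ← hY.1 j]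
        simp
      · rw [Function.update_of_ne h, hY.1 j]
    · intro Y _
      rw [Function.update_self, Function.update_idem, neg_neg, Function.update_eq_self]

/-- Whether a list alternates, starting with `s`. -/
def alternates : Bool → List Bool → ZMod 2
  | _, [] => 1
  | s, b :: t => if b = s then alternates (!s) t else 0

/-- If the signs alternate from `s`, only deleting the last term keeps this; if they alternate from
`!s`, only deleting the first term yields it. In all other cases the number of good deletions is
even, as a single repetition can be repaired by deleting either of two neighbours. -/
theorem sum_alternates_erase {α : Type*} [PartialOrder α] [DecidableEq α] (sgn : α → Bool)
    (L : List α) (hL : L.Pairwise (· ≤ ·)) (s : Bool) :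
    (L.map fun x => alternates s ((L.erase x).map sgn)).sum =
      alternates s (L.map sgn) + alternates (!s) (L.map sgn) := by
  induction L generalizing s with
  | nil => exact (CharTwo.add_self_eq_zero _).symm
  | cons a t ih =>
    have ht := (List.pairwise_cons.1 hL).2
    -- `erase` removes the first occurrence; in a sorted list equal terms are adjacent, so it does
    -- not matter which copy goes.
    have key : ∀ x ∈ t, (a :: t).erase x = a :: t.erase x := by
      intro x hx
      by_cases h : a = x
      · subst h
        cases t with
        | nil => simp at hx
        | cons b t =>
          have hab : a = b := by
            refine le_antisymm ((List.pairwise_cons.1 hL).1 b (by simp)) ?_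
            rcases List.mem_cons.1 hx with h | h
            · exact h.ge
            · exact (List.pairwise_cons.1 ht).1 _ h
          subst hab
          simp
      · rw [List.erase_cons_tail (by simpa using h)]
    have hmap : (t.map fun x => alternates s (((a :: t).erase x).map sgn)) =
        t.map fun x => alternates s ((a :: t.erase x).map sgn) :=
      List.map_congr_left fun x hx => by rw [key x hx]
    rw [List.map_cons, List.sum_cons, hmap]
    simp only [List.erase_cons_head, List.map_cons, alternates]
    by_cases h : sgn a = s
    · have h' : sgn a ≠ !s := by rw [h]; simp
      simp only [h, if_true, ih ht, Bool.not_not]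
      rw [← add_assoc]
      have := CharTwo.add_self_eq_zero (alternates s (t.map sgn))
      simp [add_comm, ← add_assoc, this]
    · have h' : sgn a = !s := by
        cases h1 : sgn a <;> cases s <;> simp_all
      simp [h']

theorem pairwise_erase {α : Type*} [DecidableEq α] {R : α → α → Prop} {L : List α}
    (h : L.Pairwise R) (x : α) : (L.erase x).Pairwise R :=
  h.sublist List.erase_sublist

/-- Whether the signs of the members of a multiset of signed numbers alternate when the
members are sorted. -/
def multisetAlternates (m : Multiset (ℕ ×ₗ Bool)) : ZMod 2 :=
  alternates false ((m.sort (· ≤ ·)).map fun y => (ofLex y).2)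

/-- The signed number with the opposite sign. -/
def flipSign (x : ℕ ×ₗ Bool) : ℕ ×ₗ Bool := toLex ((ofLex x).1, !(ofLex x).2)

theorem alternates_map_not (s : Bool) (l : List Bool) :
    alternates s (l.map not) = alternates (!s) l := by
  induction l generalizing s with
  | nil => rfl
  | cons b t ih =>
    simp only [List.map_cons, alternates, ih]
    congr 1
    cases b <;> cases s <;> simp

/-- By `hm` equal absolute values carry equal signs, so flipping all signs keeps the list sorted and
only changes the sign with which an alternation must start. -/
theorem coboundary_multisetAlternates (m : Multiset (ℕ ×ₗ Bool))
    (hm : ∀ x ∈ m, ∀ y ∈ m, (ofLex x).1 = (ofLex y).1 → (ofLex x).2 = (ofLex y).2) :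
    coboundary multisetAlternates m =
      multisetAlternates m + multisetAlternates (m.map flipSign) := by
  obtain ⟨L, hL, rfl⟩ : ∃ L : List (ℕ ×ₗ Bool), L.Pairwise (· ≤ ·) ∧ (L : Multiset _) = m :=
    ⟨m.sort (· ≤ ·), Multiset.pairwise_sort _ _, Multiset.sort_eq _ _⟩
  have hsort : ∀ l : List (ℕ ×ₗ Bool), l.Pairwise (· ≤ ·) →
      multisetAlternates (l : Multiset _) = alternates false (l.map fun y => (ofLex y).2) := by
    intro l hl
    rw [multisetAlternates]
    congr 2
    exact List.Perm.eq_of_pairwise' (Multiset.pairwise_sort _ _) hl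
      (Multiset.coe_eq_coe.1 (Multiset.sort_eq _ _))
  refine Eq.trans ?_ ((sum_alternates_erase (fun y => (ofLex y).2) L hL false).trans ?_)
  · rw [coboundary, Multiset.map_coe, Multiset.sum_coe]
    congr 1
    refine List.map_congr_left fun x _ => ?_
    rw [Multiset.coe_erase]
    exact hsort _ (pairwise_erase hL x)
  rw [hsort L hL, Multiset.map_coe, hsort]
  · congr 1
    rw [← alternates_map_not, List.map_map, List.map_map]
    rfl
  · rw [List.pairwise_map]
    refine hL.imp_of_mem fun {a b} ha hb hab => ?_
    have := hm a ha b hb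
    rw [Prod.Lex.le_iff] at hab ⊢
    rcases hab with h | h
    · exact Or.inl h
    · refine Or.inr ⟨h.1, ?_⟩
      simp [flipSign, this h.1]

theorem pairwise_lt_of_alternates (L : List (ℕ ×ₗ Bool)) (hL : L.Pairwise (· ≤ ·))
    (hm : ∀ x ∈ L, ∀ y ∈ L, (ofLex x).1 = (ofLex y).1 → (ofLex x).2 = (ofLex y).2) (s : Bool)
    (h : alternates s (L.map fun y => (ofLex y).2) ≠ 0) :
    (L.map fun y => (ofLex y).1).IsChain (· < ·) := by
  induction L generalizing s with
  | nil => simp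
  | cons a t ih =>
    simp only [List.map_cons, alternates] at h
    have ha : (ofLex a).2 = s := by by_contra h'; simp [h'] at h
    simp only [ha, if_true] at h
    have ih := ih (List.pairwise_cons.1 hL).2
      (fun x hx y hy => hm x (by simp [hx]) y (by simp [hy])) _ h
    cases t with
    | nil => simp
    | cons b t =>
      simp only [List.map_cons, alternates] at h
      have hb : (ofLex b).2 = !s := by by_contra h'; simp [h'] at h
      simp only [List.map_cons, List.isChain_cons_cons] at ih ⊢
      refine ⟨?_, ih⟩
      have hab := (List.pairwise_cons.1 hL).1 b (by simp)
      rw [Prod.Lex.le_iff] at hab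
      rcases hab with h' | h'
      · exact h'
      · have := hm a (by simp) b (by simp) h'.1
        rw [ha, hb] at this
        simp at this

/-- The octahedral version of Tucker's lemma. -/
theorem octahedral_tucker {N M : ℕ} (lam : (Fin N → SignType) → ℕ ×ₗ Bool)
    (hneg : ∀ X, X ≠ 0 → lam (-X) = flipSign (lam X))
    (hM : ∀ X, X ≠ 0 → (ofLex (lam X)).1 < M)
    (hcomp : ∀ X Y, X ≠ 0 → Y ≠ 0 → SignSub X Y → (ofLex (lam X)).1 = (ofLex (lam Y)).1 →
      (ofLex (lam X)).2 = (ofLex (lam Y)).2) : N ≤ M := by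
  set P : Multiset (Fin N → SignType) → ZMod 2 := fun m => multisetAlternates (m.map lam) with hP
  have hflag : ∀ (m : Multiset (Fin N → SignType)) Y, IsFlag m Y → ∀ x ∈ m.map lam,
      ∀ y ∈ m.map lam, (ofLex x).1 = (ofLex y).1 → (ofLex x).2 = (ofLex y).2 := by
    intro m Y hm x hx' y hy' hxy
    obtain ⟨x, hx, rfl⟩ := Multiset.mem_map.1 hx'
    obtain ⟨y, hy, rfl⟩ := Multiset.mem_map.1 hy'
    rcases hm.2 x hx y hy with h | h
    · exact hcomp x y (hm.1 x hx).1 (hm.1 y hy).1 h hxy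
    · exact (hcomp y x (hm.1 y hy).1 (hm.1 x hx).1 h hxy.symm).symm
  have hcob : ∀ (m : Multiset (Fin N → SignType)) Y, IsFlag m Y →
      coboundary P m = P m + P (m.map Neg.neg) := by
    intro m Y hm
    have h1 : coboundary P m = coboundary multisetAlternates (m.map lam) := by
      rw [coboundary, coboundary, Multiset.map_map]
      congr 1
      refine Multiset.map_congr rfl fun x hx => ?_
      simp only [hP, Function.comp, Multiset.map_erase_of_mem _ _ hx]
    have h2 : (m.map Neg.neg).map lam = (m.map lam).map flipSign := by
      rw [Multiset.map_map, Multiset.map_map]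
      exact Multiset.map_congr rfl fun x hx => hneg x (hm.1 x hx).1
    rw [h1, coboundary_multisetAlternates _ (hflag m Y hm)]
    simp only [hP, h2]
  -- The number of alternating full flags is odd in every dimension, starting from the empty flag.
  have hsum : ∀ k ≤ N, ∑ Y ∈ initialSupport N k, flagSum k Y P = 1 := by
    intro k
    induction k with
    | zero =>
      intro _
      have : initialSupport N 0 = {0} := by
        ext Y
        simp [initialSupport, funext_iff]
      rw [this, Finset.sum_singleton]
      simp [flagSum, hP, multisetAlternates, alternates]
    | succ k ih =>
      intro hk
      rw [sum_flagSum_initialSupport_succ hk P hcob]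
      exact ih (by omega)
  have hne : ∑ Y ∈ initialSupport N N, flagSum N Y P ≠ 0 := by rw [hsum N le_rfl]; simp
  obtain ⟨Y, _, hY⟩ := Finset.exists_ne_zero_of_sum_ne_zero hne
  obtain ⟨m, hmc, hm, hPm⟩ : ∃ m, Multiset.card m = N ∧ IsFlag m Y ∧ P m ≠ 0 := by
    by_contra! hcon
    refine hY ((flagSum_congr N Y P (fun _ => 0) hcon).trans ?_)
    have : ∀ (k : ℕ) (Z : Fin N → SignType), flagSum k Z (fun _ => 0) = 0 := by
      intro k
      induction k with
      | zero => intro Z; rfl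
      | succ k ih => intro Z; simp [flagSum, ih]
    exact this N Y
  set L := (m.map lam).sort (· ≤ ·) with hL
  have hmem : ∀ x, x ∈ L ↔ x ∈ m.map lam := fun x => Multiset.mem_sort _
  have hchain := pairwise_lt_of_alternates L (Multiset.pairwise_sort _ _)
    (fun x hx y hy => hflag m Y hm x ((hmem x).1 hx) y ((hmem y).1 hy)) false hPm
  have hnodup : (L.map fun y => (ofLex y).1).Nodup :=
    (List.isChain_iff_pairwise.1 hchain).imp fun h => h.ne
  -- An alternating flag of `N` vectors has `N` distinct absolute values, all below `M`.
  have hlen : (L.map fun y => (ofLex y).1).length = N := by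
    simp [hL, hmc]
  have hsub : (L.map fun y => (ofLex y).1).toFinset ⊆ Finset.range M := by
    intro j hj
    simp only [List.mem_toFinset, List.mem_map] at hj
    obtain ⟨x, hx, rfl⟩ := hj
    obtain ⟨X, hX, rfl⟩ := Multiset.mem_map.1 ((hmem x).1 hx)
    exact Finset.mem_range.2 (hM X (hm.1 X hX).1)
  have := Finset.card_le_card hsub
  rwa [List.toFinset_card_of_nodup hnodup, hlen, Finset.card_range] at this

/-! ### Longest alternating subsequences and their first sign. -/

/-- `l` is an alternating subsequence of nonzero terms of `X`. -/
def IsAltSublist {n : ℕ} (X : Fin n → SignType) (l : List SignType) : Prop :=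
  l.Sublist (List.ofFn X) ∧ 0 ∉ l ∧ l.IsChain (· ≠ ·)

section AlternationNumber

variable {n : ℕ} {X Y : Fin n → SignType}

theorem bddAbove_altSublist_length (X : Fin n → SignType) :
    BddAbove {k | ∃ l : List SignType, l.Sublist (List.ofFn X) ∧ 0 ∉ l ∧ l.IsChain (· ≠ ·) ∧
      l.length = k} := by
  refine ⟨n, ?_⟩
  rintro k ⟨l, hl, _, _, rfl⟩
  simpa using hl.length_le

theorem IsAltSublist.length_le {l : List SignType} (h : IsAltSublist X l) :
    l.length ≤ alternationNumber X :=
  le_csSup (bddAbove_altSublist_length X) ⟨l, h.1, h.2.1, h.2.2, rfl⟩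

theorem exists_isAltSublist (X : Fin n → SignType) :
    ∃ l, IsAltSublist X l ∧ l.length = alternationNumber X := by
  obtain ⟨l, h1, h2, h3, h4⟩ := Nat.sSup_mem (s := {k | ∃ l : List SignType,
    l.Sublist (List.ofFn X) ∧ 0 ∉ l ∧ l.IsChain (· ≠ ·) ∧ l.length = k})
    ⟨0, [], by simp, by simp, by simp, rfl⟩ (bddAbove_altSublist_length X)
  exact ⟨l, ⟨h1, h2, h3⟩, h4⟩

theorem alternationNumber_le (X : Fin n → SignType) : alternationNumber X ≤ n := by
  obtain ⟨l, hl, h⟩ := exists_isAltSublist X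
  rw [← h]
  simpa using hl.1.length_le

theorem sublist_of_forall₂_of_zero_notMem {L L' l : List SignType}
    (h : List.Forall₂ (fun a b => a ≠ 0 → a = b) L L') (hl : l.Sublist L) (h0 : 0 ∉ l) :
    l.Sublist L' := by
  induction h generalizing l with
  | nil => exact hl
  | cons hab _ ih =>
    cases hl with
    | cons _ hl => exact (ih hl h0).cons _
    | cons_cons _ hl =>
      rw [List.mem_cons, not_or] at h0
      rw [← hab (Ne.symm h0.1)]
      exact (ih hl h0.2).cons_cons _

theorem IsAltSublist.mono {l : List SignType} (h : IsAltSublist X l) (hXY : SignSub X Y) :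
    IsAltSublist Y l := by
  refine ⟨sublist_of_forall₂_of_zero_notMem (List.forall₂_iff_get.2 ⟨by simp, ?_⟩) h.1 h.2.1, h.2⟩
  intro i h1 h2 h3
  simp only [List.get_eq_getElem, List.getElem_ofFn] at h3 ⊢
  exact hXY _ h3

theorem alternationNumber_mono (hXY : SignSub X Y) : alternationNumber X ≤ alternationNumber Y := by
  obtain ⟨l, hl, h⟩ := exists_isAltSublist X
  rw [← h]
  exact (hl.mono hXY).length_le

theorem IsAltSublist.neg {l : List SignType} (h : IsAltSublist X l) :
    IsAltSublist (-X) (l.map Neg.neg) := by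
  refine ⟨?_, ?_, ?_⟩
  · have := h.1.map Neg.neg
    rwa [List.map_ofFn] at this
  · simpa using h.2.1
  · rw [List.isChain_map]
    exact h.2.2.imp fun a b hab => by simpa using hab

theorem alternationNumber_neg (X : Fin n → SignType) :
    alternationNumber (-X) = alternationNumber X := by
  have key : ∀ Z : Fin n → SignType, alternationNumber Z ≤ alternationNumber (-Z) := by
    intro Z
    obtain ⟨l, hl, h⟩ := exists_isAltSublist Z
    rw [← h, ← List.length_map (f := Neg.neg)]
    exact hl.neg.length_le
  exact le_antisymm (by simpa using key (-X)) (key X)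

theorem alternationNumber_pos (hX : X ≠ 0) : 0 < alternationNumber X := by
  obtain ⟨i, hi⟩ := Function.ne_iff.1 hX
  have : IsAltSublist X [X i] := by
    refine ⟨?_, ?_, by simp⟩
    · rw [List.singleton_sublist, List.mem_ofFn]
      exact ⟨i, rfl⟩
    · simpa using Ne.symm hi
  exact this.length_le

/-- Some alternating subsequence of `X` of maximum length starts with `s`. -/
def LeadsWith {n : ℕ} (X : Fin n → SignType) (s : SignType) : Prop :=
  ∃ l, IsAltSublist X (s :: l) ∧ (s :: l).length = alternationNumber X

theorem cons_cons_sublist_or {α : Type*} {L l₁ l₂ : List α} {s t : α} (hst : s ≠ t)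
    (h₁ : (s :: l₁).Sublist L) (h₂ : (t :: l₂).Sublist L) :
    (t :: s :: l₁).Sublist L ∨ (s :: t :: l₂).Sublist L := by
  induction L with
  | nil => simp at h₁
  | cons a L ih =>
    cases h₁ with
    | cons _ h₁ =>
      cases h₂ with
      | cons _ h₂ => exact (ih h₁ h₂).imp (fun h => h.cons _) fun h => h.cons _
      | cons_cons _ h₂ => exact Or.inl (h₁.cons_cons _)
    | cons_cons _ h₁ =>
      cases h₂ with
      | cons _ h₂ => exact Or.inr (h₂.cons_cons _)
      | cons_cons _ h₂ => exact absurd rfl hst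

/-- Of two longest alternating subsequences with different first signs, the one that starts later
could be extended by the first term of the other. -/
theorem LeadsWith.unique {s t : SignType} (hs : LeadsWith X s) (ht : LeadsWith X t) : s = t := by
  by_contra hst
  obtain ⟨l₁, h₁, e₁⟩ := hs
  obtain ⟨l₂, h₂, e₂⟩ := ht
  have hs0 : 0 ≠ s := fun h => h₁.2.1 (by simp [h])
  have ht0 : 0 ≠ t := fun h => h₂.2.1 (by simp [h])
  rcases cons_cons_sublist_or hst h₁.1 h₂.1 with h | h
  · have : IsAltSublist X (t :: s :: l₁) :=
      ⟨h, List.not_mem_cons_of_ne_of_not_mem ht0 h₁.2.1,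
        List.isChain_cons_cons.2 ⟨Ne.symm hst, h₁.2.2⟩⟩
    have := this.length_le
    rw [← e₁] at this
    simp at this
  · have : IsAltSublist X (s :: t :: l₂) :=
      ⟨h, List.not_mem_cons_of_ne_of_not_mem hs0 h₂.2.1, List.isChain_cons_cons.2 ⟨hst, h₂.2.2⟩⟩
    have := this.length_le
    rw [← e₂] at this
    simp at this

theorem LeadsWith.mono {s : SignType} (hs : LeadsWith X s) (hXY : SignSub X Y)
    (h : alternationNumber X = alternationNumber Y) : LeadsWith Y s := by
  obtain ⟨l, h₁, e₁⟩ := hs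
  exact ⟨l, h₁.mono hXY, e₁.trans h⟩

theorem LeadsWith.neg {s : SignType} (hs : LeadsWith X s) : LeadsWith (-X) (-s) := by
  obtain ⟨l, h₁, e₁⟩ := hs
  exact ⟨l.map Neg.neg, h₁.neg, by rw [alternationNumber_neg, ← e₁]; simp⟩

theorem leadsWith_one_or (hX : X ≠ 0) : LeadsWith X 1 ∨ LeadsWith X (-1) := by
  obtain ⟨l, hl, h⟩ := exists_isAltSublist X
  cases l with
  | nil => exact absurd h (alternationNumber_pos hX).ne
  | cons s l =>
    have hs : s ≠ 0 := fun h => hl.2.1 (by simp [h])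
    have : s = 1 ∨ s = -1 := by clear h hl; revert s; decide
    rcases this with rfl | rfl
    · exact Or.inl ⟨l, hl, h⟩
    · exact Or.inr ⟨l, hl, h⟩

theorem leadsWith_neg_one_iff (hX : X ≠ 0) : LeadsWith X (-1) ↔ ¬LeadsWith X 1 := by
  refine ⟨fun h h' => ?_, fun h => (leadsWith_one_or hX).resolve_left h⟩
  exact absurd (h.unique h') (by decide)

end AlternationNumber

/-! ### Colourings of general Kneser graphs and the altermatic bound. -/

section Kneser

variable {α : Type*} {H : Hypergraph α} {n : ℕ} {σ : Fin n ≃ H.vertexSet}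

theorem signClass_mono {X Y : Fin n → SignType} (hXY : SignSub X Y) {s : SignType} (hs : s ≠ 0) :
    signClass H σ X s ⊆ signClass H σ Y s := by
  rintro v ⟨j, hj, rfl⟩
  exact ⟨j, by rw [← hXY j (by rw [hj]; exact hs), hj], rfl⟩

theorem signClass_neg (X : Fin n → SignType) (s : SignType) :
    signClass H σ (-X) s = signClass H σ X (-s) := by
  ext v
  simp [signClass, neg_eq_iff_eq_neg]

theorem disjoint_signClass (X : Fin n → SignType) :
    Disjoint (signClass H σ X 1) (signClass H σ X (-1)) := by
  rw [Set.disjoint_left]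
  rintro v ⟨j, hj, rfl⟩ ⟨i, hi, hij⟩
  have : i = j := σ.injective (Subtype.ext hij)
  subst this
  rw [hj] at hi
  exact absurd hi (by decide)

theorem alternationNumber_le_altOrder {X : Fin n → SignType}
    (hX : ∀ e ∈ H.edgeSet, ¬ e ⊆ signClass H σ X 1 ∧ ¬ e ⊆ signClass H σ X (-1)) :
    alternationNumber X ≤ altOrder H σ :=
  le_csSup ⟨n, by rintro k ⟨Z, _, rfl⟩; exact alternationNumber_le Z⟩ ⟨X, hX, rfl⟩

/-- Some hyperedge of colour `k` consists of vertices with sign `s`. -/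
def HasColor {c : ℕ} (C : (kneserGraph H).Coloring (Fin c)) (σ : Fin n ≃ H.vertexSet)
    (X : Fin n → SignType) (s : SignType) (k : ℕ) : Prop :=
  ∃ e : H.edgeSet, (e : Set α) ⊆ signClass H σ X s ∧ (C e : ℕ) = k

variable {c : ℕ} {C : (kneserGraph H).Coloring (Fin c)}

theorem HasColor.mono {X Y : Fin n → SignType} {s : SignType} {k : ℕ} (h : HasColor C σ X s k)
    (hXY : SignSub X Y) (hs : s ≠ 0) : HasColor C σ Y s k := by
  obtain ⟨e, he, hk⟩ := h
  exact ⟨e, he.trans (signClass_mono hXY hs), hk⟩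

theorem hasColor_neg {X : Fin n → SignType} {s : SignType} {k : ℕ} :
    HasColor C σ (-X) s k ↔ HasColor C σ X (-s) k := by
  simp [HasColor, signClass_neg]

/-- Hyperedges inside opposite sign classes are disjoint, hence adjacent, so a proper colouring
separates them. This makes the sign of the top colour well defined. -/
theorem not_hasColor_and (hH : ∅ ∉ H.edgeSet) {X : Fin n → SignType} {k : ℕ}
    (h₁ : HasColor C σ X 1 k) (h₂ : HasColor C σ X (-1) k) : False := by
  obtain ⟨e, he, hk⟩ := h₁
  obtain ⟨f, hf, hk'⟩ := h₂
  have hd : Disjoint (e : Set α) (f : Set α) := (disjoint_signClass X).mono he hf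
  have hne : e ≠ f := by
    rintro rfl
    rw [disjoint_self] at hd
    exact hH (by rw [← Set.bot_eq_empty, ← hd]; exact e.2)
  exact C.valid (show (kneserGraph H).Adj e f from ⟨hne, hd⟩) (Fin.ext (hk.trans hk'.symm))

open Classical in
/-- The largest colour of a hyperedge all of whose vertices have the same nonzero sign. -/
noncomputable def topColor (C : (kneserGraph H).Coloring (Fin c)) (σ : Fin n ≃ H.vertexSet)
    (X : Fin n → SignType) : ℕ :=
  Nat.findGreatest (fun k => HasColor C σ X 1 k ∨ HasColor C σ X (-1) k) c

theorem topColor_neg (X : Fin n → SignType) : topColor C σ (-X) = topColor C σ X := by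
  rw [topColor, topColor]
  congr 1
  ext k
  rw [hasColor_neg, hasColor_neg, neg_neg, or_comm]

theorem hasColor_topColor {X : Fin n → SignType} (hX : altOrder H σ < alternationNumber X) :
    HasColor C σ X 1 (topColor C σ X) ∨ HasColor C σ X (-1) (topColor C σ X) := by
  classical
  have : ∃ k ≤ c, HasColor C σ X 1 k ∨ HasColor C σ X (-1) k := by
    by_contra! hcon
    refine absurd (alternationNumber_le_altOrder (H := H) (σ := σ) (X := X) ?_) (not_le.2 hX)
    intro e he
    exact ⟨fun h => (hcon (C ⟨e, he⟩) (C ⟨e, he⟩).2.le).1 ⟨⟨e, he⟩, h, rfl⟩,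
      fun h => (hcon (C ⟨e, he⟩) (C ⟨e, he⟩).2.le).2 ⟨⟨e, he⟩, h, rfl⟩⟩
  obtain ⟨k, hk, h⟩ := this
  rw [topColor]
  convert Nat.findGreatest_spec (P := fun k => HasColor C σ X 1 k ∨ HasColor C σ X (-1) k) hk h

theorem topColor_lt {X : Fin n → SignType} (hX : altOrder H σ < alternationNumber X) :
    topColor C σ X < c := by
  rcases hasColor_topColor (C := C) hX with ⟨e, _, h⟩ | ⟨e, _, h⟩ <;> rw [← h] <;> exact (C e).2

/-- The bound of Alishahi and Hajiabolhassan on the number of colours of a proper colouring of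
a general Kneser graph. -/
theorem le_altOrder_add_of_coloring (hH : ∅ ∉ H.edgeSet) (σ : Fin n ≃ H.vertexSet)
    (C : (kneserGraph H).Coloring (Fin c)) : n ≤ altOrder H σ + c := by
  classical
  set a := altOrder H σ with ha
  -- The values below `a` record a short alternation with its first sign. Those from `a` on record
  -- the largest colour of a monochromatically signed hyperedge with its sign; such a hyperedge
  -- exists as soon as the alternation exceeds `a`.
  let lam : (Fin n → SignType) → ℕ ×ₗ Bool := fun X =>
    if alternationNumber X ≤ a then toLex (alternationNumber X - 1, decide (LeadsWith X (-1)))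
    else toLex (a + topColor C σ X, decide (HasColor C σ X (-1) (topColor C σ X)))
  have lam_small : ∀ X, alternationNumber X ≤ a →
      lam X = toLex (alternationNumber X - 1, decide (LeadsWith X (-1))) := fun X h => if_pos h
  have lam_big : ∀ X, a < alternationNumber X →
      lam X = toLex (a + topColor C σ X, decide (HasColor C σ X (-1) (topColor C σ X))) :=
    fun X h => if_neg (not_le.2 h)
  refine octahedral_tucker lam ?_ ?_ ?_
  · intro X hX
    rcases le_or_gt (alternationNumber X) a with h | h
    · rw [lam_small X h, lam_small (-X) (by rwa [alternationNumber_neg]), alternationNumber_neg]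
      have : LeadsWith (-X) (-1) ↔ ¬LeadsWith X (-1) := by
        rw [leadsWith_neg_one_iff hX, not_not]
        exact ⟨fun h => by simpa using h.neg, fun h => h.neg⟩
      simp [flipSign, this]
    · rw [lam_big X h, lam_big (-X) (by rwa [alternationNumber_neg]), topColor_neg]
      have : HasColor C σ (-X) (-1) (topColor C σ X) ↔ ¬HasColor C σ X (-1) (topColor C σ X) := by
        rw [hasColor_neg, neg_neg]
        exact ⟨fun h₁ h₂ => not_hasColor_and hH h₁ h₂, fun h' =>
          (hasColor_topColor h).resolve_right h'⟩
      simp [flipSign, this]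
  · intro X hX
    have := alternationNumber_pos hX
    rcases le_or_gt (alternationNumber X) a with h | h
    · rw [lam_small X h]
      simp only [ofLex_toLex]
      omega
    · rw [lam_big X h]
      have := topColor_lt (C := C) h
      simp only [ofLex_toLex]
      omega
  · intro X Y hX hY hXY
    have hX0 := alternationNumber_pos hX
    have hY0 := alternationNumber_pos hY
    have hm := alternationNumber_mono hXY
    rcases le_or_gt (alternationNumber X) a with h | h <;>
      rcases le_or_gt (alternationNumber Y) a with h' | h'
    · rw [lam_small X h, lam_small Y h']
      simp only [ofLex_toLex]
      intro he
      have he : alternationNumber X = alternationNumber Y := by omega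
      have : LeadsWith X (-1) ↔ LeadsWith Y (-1) := by
        refine ⟨fun h => h.mono hXY he, fun h => ?_⟩
        rw [leadsWith_neg_one_iff hX]
        rw [leadsWith_neg_one_iff hY] at h
        exact fun h₁ => h (h₁.mono hXY he)
      simp [this]
    · rw [lam_small X h, lam_big Y h']
      simp only [ofLex_toLex]
      omega
    · omega
    · rw [lam_big X h, lam_big Y h']
      simp only [ofLex_toLex]
      intro he
      have he : topColor C σ X = topColor C σ Y := by omega
      have : HasColor C σ X (-1) (topColor C σ X) ↔ HasColor C σ Y (-1) (topColor C σ Y) := by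
        rw [← he]
        refine ⟨fun h => h.mono hXY (by decide), fun h₁ => ?_⟩
        refine (hasColor_topColor h).resolve_left fun h₂ => ?_
        exact not_hasColor_and hH (h₂.mono hXY (by decide)) h₁
      simp [this]

end Kneser

theorem ncard_sub_altHypergraph_le_chromaticNumber {α : Type*} {H : Hypergraph α}
    (hfin : H.vertexSet.Finite) (hH : ∅ ∉ H.edgeSet) :
    ((H.vertexSet.ncard - altHypergraph H : ℕ) : ℕ∞) ≤ (kneserGraph H).chromaticNumber := by
  refine le_iInf₂ fun c hc => ?_
  obtain ⟨C⟩ := hc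
  have : Finite H.vertexSet := hfin
  have hne : Nonempty (Fin H.vertexSet.ncard ≃ H.vertexSet) :=
    ⟨(Finite.equivFinOfCardEq (Nat.card_coe_set_eq _)).symm⟩
  obtain ⟨σ, hσ⟩ := Nat.sInf_mem (Set.range_nonempty
    fun σ : Fin H.vertexSet.ncard ≃ H.vertexSet => altOrder H σ)
  have h := le_altOrder_add_of_coloring hH σ C
  have h' : altHypergraph H = altOrder H σ := hσ.symm
  rw [h']
  exact Nat.cast_le.2 (by omega)

theorem altermaticNumber_le_chromaticNumber {V : Type*} (G : SimpleGraph V) :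
    altermaticNumber G ≤ G.chromaticNumber := by
  refine iSup_le fun α => iSup_le fun H => iSup_le fun hfin => iSup_le fun hH => iSup_le fun h => ?_
  obtain ⟨f⟩ := h.1
  exact (ncard_sub_altHypergraph_le_chromaticNumber hfin hH).trans
    (SimpleGraph.chromaticNumber_mono_of_hom f)

theorem le_altermaticNumber {V : Type*} {G : SimpleGraph V} {α : Type} {H : Hypergraph α}
    (hfin : H.vertexSet.Finite) (hH : ∅ ∉ H.edgeSet) (h : HomEquivalent (kneserGraph H) G)
    {n : ℕ} (hn : H.vertexSet.ncard = n) (σ : Fin n ≃ H.vertexSet) :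
    ((n - altOrder H σ : ℕ) : ℕ∞) ≤ altermaticNumber G := by
  subst hn
  have h1 : altHypergraph H ≤ altOrder H σ := Nat.sInf_le ⟨σ, rfl⟩
  refine le_trans (Nat.cast_le.2 (Nat.sub_le_sub_left h1 _)) ?_
  exact le_iSup_of_le α (le_iSup_of_le H (le_iSup_of_le hfin (le_iSup_of_le hH
    (le_iSup_of_le h le_rfl))))

/-! ### Balanced vectors and covers by lines. -/

theorem exists_prefix_sums_of_sublist {l L : List SignType} (h : l.Sublist L) (h0 : 0 ∉ l)
    (hc : l.IsChain (· ≠ ·)) :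
    ∃ Z : List ℤ, List.Forall₂ (fun (z : ℤ) (x : SignType) => z = 0 ∨ z = x) Z L ∧
      (Z.map Int.natAbs).sum = l.length ∧
      ∀ p, (Z.take p).sum = 0 ∨ ∃ s ∈ l.head?, (Z.take p).sum = (s : ℤ) := by
  induction h with
  | slnil => exact ⟨[], by simp, by simp, by simp⟩
  | cons a _ ih =>
    obtain ⟨Z, h1, h2, h3⟩ := ih h0 hc
    refine ⟨0 :: Z, List.Forall₂.cons (Or.inl rfl) h1, by simpa using h2, fun p => ?_⟩
    cases p with
    | zero => exact Or.inl rfl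
    | succ p => simpa using h3 p
  | @cons_cons l L a _ ih =>
    rw [List.mem_cons, not_or] at h0
    obtain ⟨Z, h1, h2, h3⟩ := ih h0.2 (by cases l <;> simp_all)
    have ha : ((a : ℤ)).natAbs = 1 := by
      have := h0.1
      clear * - this
      revert a; decide
    refine ⟨(a : ℤ) :: Z, List.Forall₂.cons (Or.inr rfl) h1, ?_, fun p => ?_⟩
    · rw [List.map_cons, List.sum_cons, h2, ha, List.length_cons, add_comm]
    · cases p with
      | zero => exact Or.inl rfl
      | succ p =>
        rcases h3 p with h | ⟨s, hs, h⟩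
        · refine Or.inr ⟨a, by simp, by simp [h]⟩
        · left
          cases l with
          | nil => simp at hs
          | cons b l =>
            simp only [List.head?_cons, Option.mem_def, Option.some.injEq] at hs
            subst hs
            rw [List.take_succ_cons, List.sum_cons, h]
            have hab := (List.isChain_cons_cons.1 hc).1
            have hb : b ≠ 0 := fun hb => h0.2 (by simp [hb])
            have ha := h0.1
            clear * - hab ha hb
            revert a b; decide

/-- Keeping just the terms of a longest alternating subsequence, every prefix sum is 0 or the first
sign; a sum over an interval is a difference of two prefix sums. -/
theorem exists_balanced {N : ℕ} (X : Fin N → SignType) :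
    ∃ Y : Fin N → ℤ, (∀ j, Y j = 0 ∨ Y j = (X j : ℤ)) ∧ ∑ j, |Y j| = alternationNumber X ∧
      ∀ J : Finset (Fin N), (J : Set (Fin N)).OrdConnected → |∑ j ∈ J, Y j| ≤ 1 := by
  obtain ⟨l, hl, hlen⟩ := exists_isAltSublist X
  obtain ⟨Z, h1, h2, h3⟩ := exists_prefix_sums_of_sublist hl.1 hl.2.1 hl.2.2
  have hZ : Z.length = N := by simpa using h1.length_eq
  subst hZ
  refine ⟨fun j => Z.get j, fun j => ?_, ?_, fun J hJ => ?_⟩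
  · have := (List.forall₂_iff_get.1 h1).2 j j.2 (by simp)
    simpa using this
  · rw [← hlen, ← h2]
    conv_rhs => rw [← List.ofFn_get Z, List.map_ofFn, List.sum_ofFn]
    push_cast
    simp
  · have hpre : ∀ p, (Z.take p).sum = ∑ j : Fin Z.length with j.val < p, Z.get j := by
      intro p
      conv_lhs => rw [← List.ofFn_get Z]
      exact List.sum_take_ofFn _ p
    rcases J.eq_empty_or_nonempty with rfl | hne
    · simp
    · set a := J.min' hne
      set b := J.max' hne
      have hab : a ≤ b := J.min'_le _ (J.max'_mem hne)
      have hsplit : (Finset.univ.filter fun j : Fin Z.length => (j : ℕ) < b + 1) =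
          (Finset.univ.filter fun j : Fin Z.length => (j : ℕ) < a) ∪ J := by
        ext j
        simp only [Finset.mem_filter, Finset.mem_univ, true_and, Finset.mem_union]
        constructor
        · intro h
          by_cases h' : (j : ℕ) < a
          · exact Or.inl h'
          · right
            exact hJ.out (J.min'_mem hne) (J.max'_mem hne)
              ⟨Fin.le_def.2 (not_lt.1 h'), Fin.le_def.2 (by omega)⟩
        · rintro (h | h)
          · have := Fin.le_def.1 hab
            omega
          · have := Fin.le_def.1 (J.le_max' j h)
            omega
      have hdisj : Disjoint (Finset.univ.filter fun j : Fin Z.length => (j : ℕ) < a) J := by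
        rw [Finset.disjoint_left]
        intro j hj hjJ
        have := Fin.le_def.1 (J.min'_le j hjJ)
        simp only [Finset.mem_filter, Finset.mem_univ, true_and] at hj
        omega
      have hsum : ∑ j ∈ J, Z.get j = (Z.take (b + 1)).sum - (Z.take a).sum := by
        rw [hpre, hpre, hsplit, Finset.sum_union hdisj]
        ring
      rw [hsum]
      have hs : ∀ s : SignType, |(s : ℤ)| ≤ 1 := by decide
      rcases h3 (b + 1) with h | ⟨s, hs1, h⟩ <;> rcases h3 a with h' | ⟨s', hs2, h'⟩ <;> rw [h, h']
      · simp
      · rw [zero_sub, abs_neg]; exact hs s'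
      · rw [sub_zero]; exact hs s
      · have : s = s' := Option.some.inj (hs1.symm.trans hs2)
        simp [this]

/-- This is König's theorem, obtained from Hall's theorem in its deficiency form. -/
theorem exists_cover_of_no_matching {α β : Type*} [Fintype α] [Fintype β] [DecidableEq α]
    [DecidableEq β] (rel : α → β → Prop) (r : ℕ)
    (h : ∀ (f : Fin r → α) (g : Fin r → β), Function.Injective f → Function.Injective g →
      ∃ k, ¬rel (f k) (g k)) :
    ∃ (P : Finset α) (Q : Finset β), (∀ a b, rel a b → a ∈ P ∨ b ∈ Q) ∧ P.card + Q.card < r := by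
  classical
  let t : α → Finset β := fun a => Finset.univ.filter (rel a)
  obtain ⟨A, -, hA⟩ := Finset.exists_max_image (Finset.univ : Finset (Finset α))
    (fun A => (A.card : ℤ) - (A.biUnion t).card) ⟨∅, by simp⟩
  have hd0 := hA ∅ (by simp)
  simp only [Finset.card_empty, Finset.biUnion_empty, Nat.cast_zero, sub_zero] at hd0
  obtain ⟨d, hd⟩ := Int.eq_ofNat_of_zero_le hd0
  refine ⟨Aᶜ, A.biUnion t, fun a b hab => ?_, ?_⟩
  · by_cases ha : a ∈ A
    · exact Or.inr (Finset.mem_biUnion.2 ⟨a, ha, by simp [t, hab]⟩)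
    · exact Or.inl (by simpa using ha)
  by_contra! hcard
  -- With `d` the maximal deficiency, `d` dummy partners related to everything restore Hall's
  -- condition. At most `d` elements are then matched to dummies, and the cover has `|α| - d`
  -- elements.
  have hHall : ∀ B : Finset α,
      B.card ≤ (B.biUnion fun a => (t a).disjSum (Finset.univ : Finset (Fin d))).card := by
    intro B
    rcases B.eq_empty_or_nonempty with rfl | ⟨b, hb⟩
    · simp
    · have : (B.biUnion fun a => (t a).disjSum (Finset.univ : Finset (Fin d))) =
          (B.biUnion t).disjSum Finset.univ := by
        ext x
        rcases x with x | x
        · simp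
        · simpa using ⟨b, hb⟩
      rw [this, Finset.card_disjSum, Finset.card_univ, Fintype.card_fin]
      have := hA B (by simp)
      omega
  obtain ⟨φ, hφ, hφt⟩ := (Finset.all_card_le_biUnion_card_iff_exists_injective _).1 hHall
  set B := Finset.univ.filter fun a => (φ a).isLeft = true with hB
  have hBcard : r ≤ B.card := by
    have h1 : (Finset.univ.filter fun a => ¬(φ a).isLeft = true).card ≤ d := by
      have : (Finset.univ.filter fun a => ¬(φ a).isLeft = true).image φ ⊆
          (Finset.univ : Finset (Fin d)).map Function.Embedding.inr := by
        intro x hx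
        simp only [Finset.mem_image, Finset.mem_filter, Finset.mem_univ, true_and] at hx
        obtain ⟨a, ha, rfl⟩ := hx
        rcases h : φ a with y | y
        · simp [h] at ha
        · simp
      have := Finset.card_le_card this
      rwa [Finset.card_image_of_injective _ hφ, Finset.card_map, Finset.card_univ,
        Fintype.card_fin] at this
    have h2 : B.card + _ = _ := Finset.card_filter_add_card_filter_not
      (s := (Finset.univ : Finset α)) (fun a => (φ a).isLeft = true)
    have h3 := Finset.card_compl_add_card A
    rw [Finset.card_univ] at h2
    omega
  have e : Fin r ↪ B := (Fin.castLEEmb hBcard).trans B.equivFin.symm.toEmbedding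
  have hleft : ∀ k, ∃ b, φ (e k) = Sum.inl b := by
    intro k
    have := (Finset.mem_filter.1 (e k).2).2
    exact Sum.isLeft_iff.1 this
  choose g hg using hleft
  obtain ⟨k, hk⟩ := h (fun k => e k) g (fun x y hxy => e.injective (Subtype.ext hxy)) (by
    intro x y hxy
    have : φ (e x) = φ (e y) := by rw [hg, hg, hxy]
    exact e.injective (Subtype.ext (hφ this)))
  have := hφt (e k)
  rw [hg k] at this
  simp only [t, Finset.inl_mem_disjSum, Finset.mem_filter, Finset.mem_univ, true_and] at this
  exact hk this

/-! ### Counting nonzero cells in the part read by rows. -/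

theorem sum_range_two_mul_le {a : ℕ} (g : ℕ → ℤ) (hg : ∀ i, 0 ≤ g i) :
    ∑ t ∈ Finset.range (a / 2), (g (2 * t) + g (2 * t + 1)) ≤ ∑ i ∈ Finset.range a, g i := by
  have h : ∀ k, ∑ t ∈ Finset.range k, (g (2 * t) + g (2 * t + 1)) =
      ∑ i ∈ Finset.range (2 * k), g i := by
    intro k
    induction k with
    | zero => simp
    | succ k ih =>
      rw [Finset.sum_range_succ, ih, show 2 * (k + 1) = 2 * k + 1 + 1 by ring,
        Finset.sum_range_succ, Finset.sum_range_succ]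
      ring
  rw [h]
  refine Finset.sum_le_sum_of_subset_of_nonneg ?_ fun i _ _ => hg i
  exact Finset.range_subset_range.2 (by omega)

/-- There are at most `Q.card` entries `ε`, and by balance at most one more of the opposite sign. -/
theorem sum_abs_le_of_abs_sum_le {β : Type*} (s : Finset β) (y : β → ℤ) (hy : ∀ j, |y j| ≤ 1)
    (hs : |∑ j ∈ s, y j| ≤ 1) (Q : Finset β) (ε : ℤ) (hε : ε = 1 ∨ ε = -1)
    (hQ : ∀ j, y j = ε → j ∈ Q) : ∑ j ∈ s, |y j| ≤ 2 * Q.card + 1 := by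
  classical
  have h1 : ∀ j, |y j| ≤ -ε * y j + 2 * (if j ∈ Q then 1 else 0) := by
    intro j
    have h := abs_le.1 (hy j)
    have h' : y j = -1 ∨ y j = 0 ∨ y j = 1 := by omega
    have hj := hQ j
    rcases hε with rfl | rfl <;> rcases h' with h' | h' | h' <;> rw [h'] at hj ⊢ <;>
      split_ifs <;> simp_all
  calc ∑ j ∈ s, |y j| ≤ ∑ j ∈ s, (-ε * y j + 2 * (if j ∈ Q then 1 else 0)) :=
        Finset.sum_le_sum fun j _ => h1 j
    _ = -ε * ∑ j ∈ s, y j + 2 * ((s.filter (· ∈ Q)).card : ℤ) := by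
        rw [Finset.sum_add_distrib, ← Finset.mul_sum, ← Finset.mul_sum, Finset.sum_boole]
    _ ≤ 2 * Q.card + 1 := by
        have h2 : (s.filter (· ∈ Q)).card ≤ Q.card :=
          Finset.card_le_card fun j hj => (Finset.mem_filter.1 hj).2
        have h3 := abs_le.1 hs
        rcases hε with rfl | rfl <;> omega

/-- In a palindromic pair of rows, not all entries that the columns in `Q` allow can be nonzero. -/
theorem palindromic_pair {b : ℕ} (S : ℕ → Prop) [DecidablePred S] (y z : ℕ → ℤ) (Q : Finset ℕ)
    (hyz : ∀ e, |∑ j ∈ Finset.range b with e ≤ j ∧ S j, (y j + z j)| ≤ 1)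
    (hQ : ∀ j, j ∉ Q → y j = 0 ∧ z j = 0) {d : ℕ} (hd : d < b) (hSd : S d)
    (ε : ℤ) (hε : ε = 1 ∨ ε = -1) (hyd : y d = ε) (hzd : z d = ε)
    (hfull : ∀ j ∈ Q, j < b → S j → |y j| = 1 ∧ |z j| = 1) : False := by
  have hsplit : (Finset.range b).filter (fun j => d ≤ j ∧ S j) =
      insert d ((Finset.range b).filter fun j => d + 1 ≤ j ∧ S j) := by
    ext j
    simp only [Finset.mem_filter, Finset.mem_range, Finset.mem_insert]
    constructor
    · rintro ⟨h1, h2, h3⟩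
      rcases eq_or_ne j d with h | h
      · exact Or.inl h
      · exact Or.inr ⟨h1, by omega, h3⟩
    · rintro (rfl | ⟨h1, h2, h3⟩)
      · exact ⟨hd, le_rfl, hSd⟩
      · exact ⟨h1, by omega, h3⟩
  have h1 := hyz d
  have h2 := abs_le.1 (hyz (d + 1))
  rw [hsplit, Finset.sum_insert (by simp), hyd, hzd] at h1
  have h1 := abs_le.1 h1
  -- The two equal entries in column `d` contribute `2ε`, so balance from `d` on and from `d + 1` on
  -- forces the latter sum to be `-ε`. If nothing is missing, that sum is even.
  have heven : (2 : ℤ) ∣ ∑ j ∈ Finset.range b with d + 1 ≤ j ∧ S j, (y j + z j) := by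
    refine Finset.dvd_sum fun j hj => ?_
    simp only [Finset.mem_filter, Finset.mem_range] at hj
    by_cases hjQ : j ∈ Q
    · obtain ⟨h3, h4⟩ := hfull j hjQ hj.1 hj.2.2
      rcases (abs_eq one_pos.le).1 h3 with h | h <;> rcases (abs_eq one_pos.le).1 h4 with h' | h' <;>
        rw [h, h'] <;> decide
    · obtain ⟨h3, h4⟩ := hQ j hjQ
      rw [h3, h4]; decide
  rcases hε with rfl | rfl <;> omega

open scoped symmDiff in
/-- A bound for the number of nonzero entries of a balanced array that is read row by row,
rows `2 * t` and `2 * t + 1` in opposite directions. -/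
theorem sum_abs_le_of_row_order (a b : ℕ) (S : ℕ → ℕ → Prop) [∀ i, DecidablePred (S i)]
    (Y : ℕ → ℕ → ℤ) (Pp Pm Qp Qm : Finset ℕ) (G R : ℕ)
    (hY : ∀ i j, |Y i j| ≤ 1)
    (hp : ∀ i j, Y i j = 1 → i ∈ Pp ∨ j ∈ Qp) (hm : ∀ i j, Y i j = -1 → i ∈ Pm ∨ j ∈ Qm)
    (hPp : Pp ⊆ Finset.range a) (hPm : Pm ⊆ Finset.range a)
    (hQp : Qp ⊆ Finset.range b) (hQm : Qm ⊆ Finset.range b)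
    (hPpR : Pp.card ≤ R) (hPmR : Pm.card ≤ R) (hQpR : Qp.card ≤ R) (hQmR : Qm.card ≤ R)
    (hrow : ∀ i < a, |∑ j ∈ Finset.range b with S i j, Y i j| ≤ 1)
    (hpair : ∀ t, 2 * t + 1 < a → ∀ e,
      |∑ j ∈ Finset.range b with e ≤ j ∧ S (2 * t) j, (Y (2 * t) j + Y (2 * t + 1) j)| ≤ 1)
    (hS : ∀ t j, S (2 * t) j ↔ S (2 * t + 1) j)
    (hG : ∀ j < b, G ≤ ((Finset.range (a / 2)).filter fun t => S (2 * t) j).card) :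
    ∑ i ∈ Finset.range a, ∑ j ∈ Finset.range b with S i j, |Y i j| +
        (if Qp = Qm then 0 else (G : ℤ) - 2 * R) ≤
      ∑ i ∈ Pp ∩ Pm, (((Finset.range b).filter (S i)).card : ℤ) +
        (2 * R + 1) * (Pp ∆ Pm).card +
        ∑ j ∈ Qp ∪ Qm, (((Finset.range a).filter fun i => S i j).card : ℤ) := by
  classical
  set f : ℕ → ℤ := fun i => ∑ j ∈ Finset.range b with S i j, |Y i j| with hf
  set q : ℕ → ℤ := fun i => (((Qp ∪ Qm).filter (S i)).card : ℤ) with hq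
  -- `g i` is the slack of row `i`: its share of the right-hand side minus its number of nonzero
  -- cells. The allowance is the full row if both signs are covered, `2R + 1` if one is, and the
  -- cells in covering columns in any case.
  set g : ℕ → ℤ := fun i => q i +
    (if i ∈ Pp ∩ Pm then (((Finset.range b).filter (S i)).card : ℤ) else 0) +
    (if i ∈ Pp ∆ Pm then (2 * R + 1 : ℤ) else 0) - (if i < a then f i else 0) with hg
  have hq0 : ∀ i, 0 ≤ q i := fun i => Nat.cast_nonneg _
  have hzero : ∀ i, i ∉ Pp → i ∉ Pm → ∀ j, j ∉ Qp ∪ Qm → Y i j = 0 := by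
    intro i h1 h2 j hj
    rw [Finset.mem_union, not_or] at hj
    have h := abs_le.1 (hY i j)
    have h3 : Y i j ≠ 1 := fun h => (hp i j h).elim h1 hj.1
    have h4 : Y i j ≠ -1 := fun h => (hm i j h).elim h2 hj.2
    omega
  have hQb : ∀ j ∈ Qp ∪ Qm, j < b := by
    intro j hj
    rcases Finset.mem_union.1 hj with h | h
    · exact Finset.mem_range.1 (hQp h)
    · exact Finset.mem_range.1 (hQm h)
  have hfQ : ∀ i, i ∉ Pp → i ∉ Pm → f i = ∑ j ∈ (Qp ∪ Qm).filter (S i), |Y i j| := by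
    intro i h1 h2
    refine (Finset.sum_subset ?_ ?_).symm
    · intro j hj
      rw [Finset.mem_filter] at hj ⊢
      exact ⟨Finset.mem_range.2 (hQb j hj.1), hj.2⟩
    · intro j hj hj'
      rw [Finset.mem_filter] at hj hj'
      rw [hzero i h1 h2 j fun h => hj' ⟨h, hj.2⟩, abs_zero]
  have hcard : ∀ i (s : Finset ℕ), ∑ j ∈ s, |Y i j| ≤ s.card := by
    intro i s
    calc ∑ j ∈ s, |Y i j| ≤ ∑ j ∈ s, (1 : ℤ) := Finset.sum_le_sum fun j _ => hY i j
      _ = s.card := by simp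
  have hg0 : ∀ i, 0 ≤ g i := by
    intro i
    have h0 := hq0 i
    simp only [hg]
    by_cases hia : i < a
    swap
    · rw [if_neg hia]
      split_ifs <;> omega
    rw [if_pos hia]
    by_cases h1 : i ∈ Pp <;> by_cases h2 : i ∈ Pm
    · have : f i ≤ _ := hcard i ((Finset.range b).filter (S i))
      simp only [Finset.mem_inter, h1, h2, and_self, if_true, Finset.mem_symmDiff, not_true,
        and_false, or_self, if_false]
      omega
    · have : f i ≤ _ := sum_abs_le_of_abs_sum_le _ (Y i) (hY i) (hrow i hia) Qm (-1) (Or.inr rfl)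
        fun j hj => (hm i j hj).resolve_left h2
      simp only [Finset.mem_inter, h1, h2, if_true, Finset.mem_symmDiff, and_false,
        not_false_eq_true, and_true, true_or, if_false]
      omega
    · have : f i ≤ _ := sum_abs_le_of_abs_sum_le _ (Y i) (hY i) (hrow i hia) Qp 1 (Or.inl rfl)
        fun j hj => (hp i j hj).resolve_left h1
      simp only [Finset.mem_inter, h1, h2, if_true, Finset.mem_symmDiff, false_and,
        not_false_eq_true, and_true, or_true, if_false]
      omega
    · have h3 := hcard i ((Qp ∪ Qm).filter (S i))
      rw [← hfQ i h1 h2] at h3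
      simp only [Finset.mem_inter, h1, h2, Finset.mem_symmDiff, false_and, or_self, if_false]
      simp only [hq]
      omega
  have hsum : ∑ i ∈ Finset.range a, g i =
      ∑ i ∈ Pp ∩ Pm, (((Finset.range b).filter (S i)).card : ℤ) +
        (2 * R + 1) * (Pp ∆ Pm).card +
        ∑ j ∈ Qp ∪ Qm, (((Finset.range a).filter fun i => S i j).card : ℤ) -
        ∑ i ∈ Finset.range a, f i := by
    have e1 : ∑ i ∈ Finset.range a, q i =
        ∑ j ∈ Qp ∪ Qm, (((Finset.range a).filter fun i => S i j).card : ℤ) := by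
      simp only [hq, Finset.card_filter]
      push_cast
      exact Finset.sum_comm
    have e2 : ∑ i ∈ Finset.range a,
        (if i ∈ Pp ∩ Pm then (((Finset.range b).filter (S i)).card : ℤ) else 0) =
        ∑ i ∈ Pp ∩ Pm, (((Finset.range b).filter (S i)).card : ℤ) := by
      rw [← Finset.sum_filter, Finset.filter_mem_eq_inter, Finset.inter_eq_right.2]
      exact Finset.inter_subset_left.trans hPp
    have e3 : ∑ i ∈ Finset.range a, (if i ∈ Pp ∆ Pm then (2 * R + 1 : ℤ) else 0) =
        (2 * R + 1) * (Pp ∆ Pm).card := by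
      rw [← Finset.sum_filter, Finset.filter_mem_eq_inter, Finset.inter_eq_right.2]
      · simp [mul_comm]
      · exact Finset.symmDiff_subset_union.trans (Finset.union_subset hPp hPm)
    have e4 : ∑ i ∈ Finset.range a, (if i < a then f i else 0) = ∑ i ∈ Finset.range a, f i :=
      Finset.sum_congr rfl fun i hi => if_pos (Finset.mem_range.1 hi)
    simp only [hg]
    rw [Finset.sum_sub_distrib, Finset.sum_add_distrib, Finset.sum_add_distrib, e1, e2, e3, e4]
    ring
  suffices h : (if Qp = Qm then 0 else (G : ℤ) - 2 * R) ≤ ∑ i ∈ Finset.range a, g i by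
    rw [hsum] at h
    linarith
  split_ifs with hQ
  · exact Finset.sum_nonneg fun i _ => hg0 i
  -- Outside the covering rows, the entries of column `d` can have only one sign.
  obtain ⟨d, hd⟩ : (Qp ∆ Qm).Nonempty := by
    rw [Finset.nonempty_iff_ne_empty, Ne, ← Finset.bot_eq_empty, symmDiff_eq_bot]
    exact hQ
  have hdQ : d ∈ Qp ∪ Qm := Finset.symmDiff_subset_union hd
  -- These are the row pairs that meet column `d` and contain no covering row. At most `2R` pairs
  -- are excluded, and each remaining pair has positive slack: otherwise both entries in column `d`
  -- would be nonzero, hence equal, against `palindromic_pair`.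
  set T := ((Finset.range (a / 2)).filter fun t => S (2 * t) d) \ (Pp ∪ Pm).image (· / 2) with hT
  have hTG : (G : ℤ) - 2 * R ≤ T.card := by
    have h1 := hG d (hQb d hdQ)
    have h2 := Finset.le_card_sdiff ((Pp ∪ Pm).image (· / 2))
      ((Finset.range (a / 2)).filter fun t => S (2 * t) d)
    have h3 : ((Pp ∪ Pm).image (· / 2)).card ≤ _ := Finset.card_image_le
    have h4 := Finset.card_union_le Pp Pm
    rw [← hT] at h2
    omega
  refine hTG.trans (le_trans ?_ (sum_range_two_mul_le g hg0))
  calc (T.card : ℤ) = ∑ t ∈ T, 1 := by simp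
    _ ≤ ∑ t ∈ T, (g (2 * t) + g (2 * t + 1)) := ?_
    _ ≤ _ := Finset.sum_le_sum_of_subset_of_nonneg
        (Finset.sdiff_subset.trans (Finset.filter_subset _ _))
        fun t _ _ => add_nonneg (hg0 _) (hg0 _)
  refine Finset.sum_le_sum fun t ht => ?_
  simp only [hT, Finset.mem_sdiff, Finset.mem_filter, Finset.mem_range, Finset.mem_image,
    not_exists, not_and] at ht
  obtain ⟨⟨hta, hSd⟩, htP⟩ := ht
  have hn : ∀ i, i / 2 = t → i ∉ Pp ∧ i ∉ Pm := by
    intro i hi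
    have : i ∉ Pp ∪ Pm := fun h => htP i h hi
    rwa [Finset.mem_union, not_or] at this
  obtain ⟨h1, h2⟩ := hn (2 * t) (by omega)
  obtain ⟨h3, h4⟩ := hn (2 * t + 1) (by omega)
  by_contra hlt
  have hge : g (2 * t) = 0 ∧ g (2 * t + 1) = 0 := by
    have := hg0 (2 * t)
    have := hg0 (2 * t + 1)
    constructor <;> omega
  have hfull : ∀ i < a, i ∉ Pp → i ∉ Pm → g i = 0 → ∀ j ∈ Qp ∪ Qm, S i j → |Y i j| = 1 := by
    intro i hia h1 h2 hgi j hj hSj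
    simp only [hg, Finset.mem_inter, h1, h2, Finset.mem_symmDiff, false_and, or_self, if_false,
      if_pos hia, hfQ i h1 h2, hq, add_zero] at hgi
    have h0 : ∑ j ∈ (Qp ∪ Qm).filter (S i), (1 - |Y i j|) = 0 := by
      rw [Finset.sum_sub_distrib]
      simpa using hgi
    have := (Finset.sum_eq_zero_iff_of_nonneg fun j _ => sub_nonneg.2 (hY i j)).1 h0 j
      (Finset.mem_filter.2 ⟨hj, hSj⟩)
    linarith
  have hfull1 := hfull (2 * t) (by omega) h1 h2 hge.1
  have hfull2 := hfull (2 * t + 1) (by omega) h3 h4 hge.2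
  have hfin : ∀ ε : ℤ, (ε = 1 ∨ ε = -1) →
      (∀ i, i ∉ Pp → i ∉ Pm → Y i d ≠ -ε) → False := by
    intro ε hε hne
    have hval : ∀ i, i ∉ Pp → i ∉ Pm → |Y i d| = 1 → Y i d = ε := by
      intro i hi1 hi2 habs
      have := hne i hi1 hi2
      rcases (abs_eq one_pos.le).1 habs with h | h <;> rcases hε with rfl | rfl <;> omega
    exact palindromic_pair (S (2 * t)) (Y (2 * t)) (Y (2 * t + 1)) (Qp ∪ Qm)
      (hpair t (by omega)) (fun j hj => ⟨hzero _ h1 h2 j hj, hzero _ h3 h4 j hj⟩)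
      (hQb d hdQ) hSd ε hε (hval _ h1 h2 (hfull1 d hdQ hSd))
      (hval _ h3 h4 (hfull2 d hdQ ((hS t d).1 hSd)))
      fun j hj _ hSj => ⟨hfull1 j hj hSj, hfull2 j hj ((hS t j).1 hSj)⟩
  rcases Finset.mem_symmDiff.1 hd with ⟨hd1, hd2⟩ | ⟨hd1, hd2⟩
  · exact hfin 1 (Or.inl rfl) fun i hi1 hi2 h => (hm i d h).elim hi2 hd2
  · exact hfin (-1) (Or.inr rfl) fun i hi1 hi2 h => (hp i d (by simpa using h)).elim hi1 hd2

/-! ### The order on the cells and the bound for balanced arrays. -/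

/-- The position of the cell `(i, j)` of an array. The cells with `i < h ↔ j < g` come first, row
by row, the odd rows backwards, and then the others, column by column, the odd columns
backwards. -/
def cellKey (h g : ℕ) (c : ℕ × ℕ) : ℕ ×ₗ ℕ ×ₗ ℤ :=
  if c.1 < h ↔ c.2 < g then toLex (0, toLex (c.1, if c.1 % 2 = 0 then (c.2 : ℤ) else -c.2))
  else toLex (1, toLex (c.2, if c.2 % 2 = 0 then (c.1 : ℤ) else -c.1))

theorem cellKey_le_row_iff {h g i j i' j' : ℕ} (H : i < h ↔ j < g) (H' : i' < h ↔ j' < g) :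
    cellKey h g (i, j) ≤ cellKey h g (i', j') ↔
      i < i' ∨ i = i' ∧ (i % 2 = 0 ∧ j ≤ j' ∨ i % 2 = 1 ∧ j' ≤ j) := by
  simp only [cellKey, if_pos H, if_pos H', Prod.Lex.le_iff, ofLex_toLex, lt_self_iff_false,
    false_or, true_and]
  split_ifs <;> omega

theorem cellKey_le_col_iff {h g i j i' j' : ℕ} (H : ¬(i < h ↔ j < g)) (H' : ¬(i' < h ↔ j' < g)) :
    cellKey h g (i, j) ≤ cellKey h g (i', j') ↔
      j < j' ∨ j = j' ∧ (j % 2 = 0 ∧ i ≤ i' ∨ j % 2 = 1 ∧ i' ≤ i) := by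
  simp only [cellKey, if_neg H, if_neg H', Prod.Lex.le_iff, ofLex_toLex, lt_self_iff_false,
    false_or, true_and]
  split_ifs <;> omega

theorem cellKey_row_lt_col {h g i j i' j' : ℕ} (H : i < h ↔ j < g) (H' : ¬(i' < h ↔ j' < g)) :
    cellKey h g (i, j) < cellKey h g (i', j') := by
  simp only [cellKey, if_pos H, if_neg H', Prod.Lex.lt_iff, ofLex_toLex]
  omega

theorem cellKey_injective (h g : ℕ) : Function.Injective (cellKey h g) := by
  rintro ⟨i, j⟩ ⟨i', j'⟩ hc
  by_cases H : i < h ↔ j < g <;> by_cases H' : i' < h ↔ j' < g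
  · have h1 := (cellKey_le_row_iff H H').1 hc.le
    have h2 := (cellKey_le_row_iff H' H).1 hc.ge
    rw [Prod.mk.injEq]; omega
  · exact absurd hc (cellKey_row_lt_col H H').ne
  · exact absurd hc.symm (cellKey_row_lt_col H' H).ne
  · have h1 := (cellKey_le_col_iff H H').1 hc.le
    have h2 := (cellKey_le_col_iff H' H).1 hc.ge
    rw [Prod.mk.injEq]; omega

/-- The sums of `Y` over the sets of consecutive cells are at most 1 in absolute value. -/
def BalancedArray (n m h g : ℕ) (Y : ℕ → ℕ → ℤ) : Prop :=
  ∀ J : Finset (ℕ × ℕ), (∀ c ∈ J, c.1 < n ∧ c.2 < m) →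
    (∀ a ∈ J, ∀ b ∈ J, ∀ i < n, ∀ j < m, cellKey h g a ≤ cellKey h g (i, j) →
      cellKey h g (i, j) ≤ cellKey h g b → (i, j) ∈ J) → |∑ c ∈ J, Y c.1 c.2| ≤ 1

section BalancedArray

variable {n m h g : ℕ} {Y : ℕ → ℕ → ℤ}

theorem BalancedArray.row (hY : BalancedArray n m h g Y) {i : ℕ} (hi : i < n) :
    |∑ j ∈ Finset.range m with (i < h ↔ j < g), Y i j| ≤ 1 := by
  have := hY (((Finset.range m).filter fun j => i < h ↔ j < g).image fun j => (i, j)) ?_ ?_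
  · rwa [Finset.sum_image (by intro x _ y _ hxy; exact (Prod.mk.inj hxy).2)] at this
  · simp only [Finset.mem_image, Finset.mem_filter, Finset.mem_range]
    rintro _ ⟨j, hj, rfl⟩
    exact ⟨hi, hj.1⟩
  · simp only [Finset.mem_image, Finset.mem_filter, Finset.mem_range]
    rintro _ ⟨j₁, hj₁, rfl⟩ _ ⟨j₂, hj₂, rfl⟩ i' hi' j' hj' h1 h2
    by_cases H : i' < h ↔ j' < g
    · rw [cellKey_le_row_iff hj₁.2 H] at h1
      rw [cellKey_le_row_iff H hj₂.2] at h2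
      obtain rfl : i' = i := by omega
      exact ⟨j', ⟨hj', H⟩, rfl⟩
    · exact absurd h2 (not_le.2 (cellKey_row_lt_col hj₂.2 H))

theorem BalancedArray.col (hY : BalancedArray n m h g Y) {j : ℕ} (hj : j < m) :
    |∑ i ∈ Finset.range n with ¬(i < h ↔ j < g), Y i j| ≤ 1 := by
  have := hY (((Finset.range n).filter fun i => ¬(i < h ↔ j < g)).image fun i => (i, j)) ?_ ?_
  · rwa [Finset.sum_image (by intro x _ y _ hxy; exact (Prod.mk.inj hxy).1)] at this
  · simp only [Finset.mem_image, Finset.mem_filter, Finset.mem_range]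
    rintro _ ⟨i, hi, rfl⟩
    exact ⟨hi.1, hj⟩
  · simp only [Finset.mem_image, Finset.mem_filter, Finset.mem_range]
    rintro _ ⟨i₁, hi₁, rfl⟩ _ ⟨i₂, hi₂, rfl⟩ i' hi' j' hj' h1 h2
    by_cases H : i' < h ↔ j' < g
    · exact absurd h1 (not_le.2 (cellKey_row_lt_col H hi₁.2))
    · rw [cellKey_le_col_iff hi₁.2 H] at h1
      rw [cellKey_le_col_iff H hi₂.2] at h2
      obtain rfl : j' = j := by omega
      exact ⟨i', ⟨hi', H⟩, rfl⟩

/-- Row `2t` is read forwards and row `2t + 1` backwards, so the cells of both rows in columns `≥ e`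
surround the turning point and are consecutive. As `h` is even, both rows lie on the same side of
the cut. -/
theorem BalancedArray.row_pair (hY : BalancedArray n m h g Y) (hh : h % 2 = 0) {t : ℕ}
    (ht : 2 * t + 1 < n) (e : ℕ) :
    |∑ j ∈ Finset.range m with e ≤ j ∧ (2 * t < h ↔ j < g), (Y (2 * t) j + Y (2 * t + 1) j)| ≤
      1 := by
  set s := (Finset.range m).filter fun j => e ≤ j ∧ (2 * t < h ↔ j < g) with hs
  have := hY (s.image (fun j => (2 * t, j)) ∪ s.image fun j => (2 * t + 1, j)) ?_ ?_
  · rw [Finset.sum_union, Finset.sum_image (by intro x _ y _ hxy; exact (Prod.mk.inj hxy).2),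
      Finset.sum_image (by intro x _ y _ hxy; exact (Prod.mk.inj hxy).2)] at this
    · rwa [Finset.sum_add_distrib]
    · rw [Finset.disjoint_left]
      simp only [Finset.mem_image]
      rintro _ ⟨j, _, rfl⟩ ⟨j', _, hj⟩
      have := (Prod.mk.inj hj).1
      omega
  · simp only [hs, Finset.mem_union, Finset.mem_image, Finset.mem_filter, Finset.mem_range]
    rintro _ (⟨j, hj, rfl⟩ | ⟨j, hj, rfl⟩)
    · exact ⟨by omega, hj.1⟩
    · exact ⟨by omega, hj.1⟩
  · have hmem : ∀ i j, (i, j) ∈ s.image (fun j => (2 * t, j)) ∪ s.image (fun j => (2 * t + 1, j)) ↔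
        (i = 2 * t ∨ i = 2 * t + 1) ∧ j < m ∧ e ≤ j ∧ (i < h ↔ j < g) := by
      intro i j
      simp only [hs, Finset.mem_union, Finset.mem_image, Finset.mem_filter, Finset.mem_range,
        Prod.mk.injEq]
      constructor
      · rintro (⟨j', hj, rfl, rfl⟩ | ⟨j', hj, rfl, rfl⟩) <;> omega
      · rintro ⟨rfl | rfl, hj⟩
        · exact Or.inl ⟨j, by omega, rfl, rfl⟩
        · exact Or.inr ⟨j, by omega, rfl, rfl⟩
    rintro ⟨i₁, j₁⟩ hj₁ ⟨i₂, j₂⟩ hj₂ i' hi' j' hj' h1 h2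
    rw [hmem] at hj₁ hj₂ ⊢
    by_cases H : i' < h ↔ j' < g
    · rw [cellKey_le_row_iff hj₁.2.2.2 H] at h1
      rw [cellKey_le_row_iff H hj₂.2.2.2] at h2
      refine ⟨by omega, hj', by omega, H⟩
    · exact absurd h2 (not_le.2 (cellKey_row_lt_col hj₂.2.2.2 H))

theorem BalancedArray.col_pair (hY : BalancedArray n m h g Y) (hg : g % 2 = 0) {t : ℕ}
    (ht : 2 * t + 1 < m) (e : ℕ) :
    |∑ i ∈ Finset.range n with e ≤ i ∧ ¬(i < h ↔ 2 * t < g), (Y i (2 * t) + Y i (2 * t + 1))| ≤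
      1 := by
  set s := (Finset.range n).filter fun i => e ≤ i ∧ ¬(i < h ↔ 2 * t < g) with hs
  have := hY (s.image (fun i => (i, 2 * t)) ∪ s.image fun i => (i, 2 * t + 1)) ?_ ?_
  · rw [Finset.sum_union, Finset.sum_image (by intro x _ y _ hxy; exact (Prod.mk.inj hxy).1),
      Finset.sum_image (by intro x _ y _ hxy; exact (Prod.mk.inj hxy).1)] at this
    · rwa [Finset.sum_add_distrib]
    · rw [Finset.disjoint_left]
      simp only [Finset.mem_image]
      rintro _ ⟨j, _, rfl⟩ ⟨j', _, hj⟩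
      have := (Prod.mk.inj hj).2
      omega
  · simp only [hs, Finset.mem_union, Finset.mem_image, Finset.mem_filter, Finset.mem_range]
    rintro _ (⟨j, hj, rfl⟩ | ⟨j, hj, rfl⟩)
    · exact ⟨hj.1, by omega⟩
    · exact ⟨hj.1, by omega⟩
  · have hmem : ∀ i j, (i, j) ∈ s.image (fun i => (i, 2 * t)) ∪ s.image (fun i => (i, 2 * t + 1)) ↔
        (j = 2 * t ∨ j = 2 * t + 1) ∧ i < n ∧ e ≤ i ∧ ¬(i < h ↔ j < g) := by
      intro i j
      simp only [hs, Finset.mem_union, Finset.mem_image, Finset.mem_filter, Finset.mem_range,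
        Prod.mk.injEq]
      constructor
      · rintro (⟨i', hi, rfl, rfl⟩ | ⟨i', hi, rfl, rfl⟩) <;> omega
      · rintro ⟨rfl | rfl, hi⟩
        · exact Or.inl ⟨i, by omega, rfl, rfl⟩
        · exact Or.inr ⟨i, by omega, rfl, rfl⟩
    rintro ⟨i₁, j₁⟩ hj₁ ⟨i₂, j₂⟩ hj₂ i' hi' j' hj' h1 h2
    rw [hmem] at hj₁ hj₂ ⊢
    by_cases H : i' < h ↔ j' < g
    · exact absurd h1 (not_le.2 (cellKey_row_lt_col H hj₁.2.2.2))
    · rw [cellKey_le_col_iff hj₁.2.2.2 H] at h1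
      rw [cellKey_le_col_iff H hj₂.2.2.2] at h2
      refine ⟨by omega, hi', by omega, H⟩

theorem card_filter_lt_iff_ge {a : ℕ} (p : Prop) [Decidable p] :
    a / 4 ≤ ((Finset.range (a / 2)).filter fun t => 2 * t < 2 * (a / 4) ↔ p).card := by
  by_cases hp : p
  · calc a / 4 = (Finset.range (a / 4)).card := by simp
      _ ≤ _ := Finset.card_le_card fun t ht => by
        simp only [Finset.mem_filter, Finset.mem_range, hp, iff_true] at ht ⊢
        omega
  · calc a / 4 ≤ (Finset.Ico (a / 4) (a / 2)).card := by rw [Nat.card_Ico]; omega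
      _ ≤ _ := Finset.card_le_card fun t ht => by
        simp only [Finset.mem_filter, Finset.mem_range, hp, iff_false, Finset.mem_Ico] at ht ⊢
        omega

theorem card_filter_lt_iff_le {a : ℕ} (p : Prop) [Decidable p] :
    2 * ((Finset.range a).filter fun t => t < 2 * (a / 4) ↔ p).card ≤ a + 3 := by
  by_cases hp : p
  · have : ((Finset.range a).filter fun t => t < 2 * (a / 4) ↔ p).card ≤
        (Finset.range (2 * (a / 4))).card := Finset.card_le_card fun t ht => by
      simp only [Finset.mem_filter, Finset.mem_range, hp, iff_true] at ht ⊢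
      omega
    rw [Finset.card_range] at this
    omega
  · have : ((Finset.range a).filter fun t => t < 2 * (a / 4) ↔ p).card ≤
        (Finset.Ico (2 * (a / 4)) a).card := Finset.card_le_card fun t ht => by
      simp only [Finset.mem_filter, Finset.mem_range, hp, iff_false, Finset.mem_Ico] at ht ⊢
      omega
    rw [Nat.card_Ico] at this
    omega

-- A line in both covers costs its whole length `M`, one in a single cover only its part `v`, which
-- is about half of `M`.
open scoped symmDiff in
theorem sum_inter_add_sum_union_le (A B : Finset ℕ) (u v : ℕ → ℕ) (M : ℕ)
    (huv : ∀ i, u i + v i = M) (hv : ∀ i, 2 * v i ≤ M + 3) :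
    2 * (∑ i ∈ A ∩ B, (u i : ℤ) + ∑ i ∈ A ∪ B, (v i : ℤ)) ≤
      2 * (A ∩ B).card * M + (A ∆ B).card * (M + 3) := by
  have h1 : A ∪ B = (A ∩ B) ∪ (A ∆ B) := by
    ext i; simp only [Finset.mem_union, Finset.mem_inter, Finset.mem_symmDiff]; tauto
  have h2 : Disjoint (A ∩ B) (A ∆ B) := by
    rw [Finset.disjoint_left]
    intro i; simp only [Finset.mem_inter, Finset.mem_symmDiff]; tauto
  have h3 : ∑ i ∈ A ∩ B, (u i : ℤ) + ∑ i ∈ A ∩ B, (v i : ℤ) = (A ∩ B).card * M := by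
    rw [← Finset.sum_add_distrib, Finset.sum_congr rfl fun i _ => (by
      rw [← Nat.cast_add, huv] : (u i : ℤ) + v i = M)]
    simp
  have h4 : 2 * ∑ i ∈ A ∆ B, (v i : ℤ) ≤ (A ∆ B).card * (M + 3) := by
    rw [Finset.mul_sum]
    refine (Finset.sum_le_card_nsmul _ _ ((M : ℤ) + 3) fun i _ => ?_).trans (by simp)
    exact_mod_cast hv i
  rw [h1, Finset.sum_union h2]
  linarith

-- The row estimate is applied to both parts, transposed for the part read by columns. A line in
-- both covers uses two units of the budget `2R`, a line in one cover one unit, and a unit costs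
-- about `m/2` or `n/2` cells. The saving from differing covers absorbs the rest.
open scoped symmDiff in
theorem BalancedArray.sum_abs_le (R : ℕ)
    (hY : BalancedArray n m (2 * (n / 4)) (2 * (m / 4)) Y) (hnm : n ≤ m)
    (hm : 16 * R ^ 2 + 48 * R + 16 ≤ m) (hY1 : ∀ i j, |Y i j| ≤ 1)
    (Rp Rm Kp Km : Finset ℕ)
    (hp : ∀ i j, Y i j = 1 → i ∈ Rp ∨ j ∈ Kp) (hn : ∀ i j, Y i j = -1 → i ∈ Rm ∨ j ∈ Km)
    (hRp : Rp ⊆ Finset.range n) (hRm : Rm ⊆ Finset.range n)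
    (hKp : Kp ⊆ Finset.range m) (hKm : Km ⊆ Finset.range m)
    (hcp : Rp.card + Kp.card ≤ R) (hcm : Rm.card + Km.card ≤ R) :
    ∑ i ∈ Finset.range n, ∑ j ∈ Finset.range m, |Y i j| ≤ m * R := by
  have E1 := sum_abs_le_of_row_order n m (fun i j => i < 2 * (n / 4) ↔ j < 2 * (m / 4)) Y
    Rp Rm Kp Km (n / 4) R hY1 hp hn hRp hRm hKp hKm (by omega) (by omega) (by omega) (by omega)
    (fun i hi => hY.row hi) (fun t ht e => hY.row_pair (by omega) ht e)
    (fun t j => by omega) (fun j _ => card_filter_lt_iff_ge _)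
  have E2 := sum_abs_le_of_row_order m n (fun j i => ¬(i < 2 * (n / 4) ↔ j < 2 * (m / 4)))
    (fun j i => Y i j) Kp Km Rp Rm (m / 4) R (fun j i => hY1 i j) (fun j i h => (hp i j h).symm)
    (fun j i h => (hn i j h).symm) hKp hKm hRp hRm (by omega) (by omega) (by omega) (by omega)
    (fun i hi => hY.col hi) (fun t ht e => hY.col_pair (by omega) ht e)
    (fun t j => by omega) (fun i _ => by
      refine (card_filter_lt_iff_ge (a := m) (¬(i < 2 * (n / 4)))).trans_eq ?_
      congr 1
      ext t
      simp only [Finset.mem_filter]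
      tauto)
  have hsplit : ∑ i ∈ Finset.range n, ∑ j ∈ Finset.range m, |Y i j| =
      ∑ i ∈ Finset.range n, ∑ j ∈ Finset.range m with (i < 2 * (n / 4) ↔ j < 2 * (m / 4)), |Y i j| +
      ∑ j ∈ Finset.range m, ∑ i ∈ Finset.range n with ¬(i < 2 * (n / 4) ↔ j < 2 * (m / 4)),
        |Y i j| := by
    have : ∑ j ∈ Finset.range m, ∑ i ∈ Finset.range n with ¬(i < 2 * (n / 4) ↔ j < 2 * (m / 4)),
        |Y i j| = ∑ i ∈ Finset.range n, ∑ j ∈ Finset.range m with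
          ¬(i < 2 * (n / 4) ↔ j < 2 * (m / 4)), |Y i j| := by
      simp only [Finset.sum_filter]
      exact Finset.sum_comm
    rw [this, ← Finset.sum_add_distrib]
    exact Finset.sum_congr rfl fun i _ => (Finset.sum_filter_add_sum_filter_not _ _ _).symm
  have B1 := sum_inter_add_sum_union_le Rp Rm
    (fun i => ((Finset.range m).filter fun j => i < 2 * (n / 4) ↔ j < 2 * (m / 4)).card)
    (fun i => ((Finset.range m).filter fun j => ¬(i < 2 * (n / 4) ↔ j < 2 * (m / 4))).card) m
    (fun i => by rw [Finset.card_filter_add_card_filter_not, Finset.card_range])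
    (fun i => by
      refine le_trans (le_of_eq ?_) (card_filter_lt_iff_le (a := m) (¬(i < 2 * (n / 4))))
      congr 2
      ext t
      simp only [Finset.mem_filter]
      tauto)
  have B2 := sum_inter_add_sum_union_le Kp Km
    (fun j => ((Finset.range n).filter fun i => ¬(i < 2 * (n / 4) ↔ j < 2 * (m / 4))).card)
    (fun j => ((Finset.range n).filter fun i => i < 2 * (n / 4) ↔ j < 2 * (m / 4)).card) n
    (fun i => by rw [add_comm, Finset.card_filter_add_card_filter_not, Finset.card_range])
    (fun i => card_filter_lt_iff_le _)
  have hcard : ∀ A B : Finset ℕ, A.card + B.card = 2 * (A ∩ B).card + (A ∆ B).card := by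
    intro A B
    have h1 := Finset.card_union_add_card_inter A B
    have h2 : (A ∪ B).card = (A ∩ B).card + (A ∆ B).card := by
      rw [← Finset.card_union_of_disjoint]
      · congr 1
        ext i; simp only [Finset.mem_union, Finset.mem_inter, Finset.mem_symmDiff]; tauto
      · rw [Finset.disjoint_left]
        intro i; simp only [Finset.mem_inter, Finset.mem_symmDiff]; tauto
    omega
  have hRc := hcard Rp Rm
  have hKc := hcard Kp Km
  have hR0 : Rp = Rm ↔ (Rp ∆ Rm).card = 0 := by
    rw [Finset.card_eq_zero, ← Finset.bot_eq_empty, symmDiff_eq_bot]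
  have hK0 : Kp = Km ↔ (Kp ∆ Km).card = 0 := by
    rw [Finset.card_eq_zero, ← Finset.bot_eq_empty, symmDiff_eq_bot]
  rw [hsplit]
  simp only [hR0, hK0] at E1 E2
  generalize (Rp ∆ Rm).card = ρ at *
  generalize (Kp ∆ Km).card = κ at *
  generalize (Rp ∩ Rm).card = p at *
  generalize (Kp ∩ Km).card = q at *
  have htot : 2 * p + ρ + 2 * q + κ ≤ 2 * R := by omega
  have M1 : (q : ℤ) * n ≤ q * m := by gcongr
  have M2 : (κ : ℤ) * n ≤ κ * m := by gcongr
  have M3 : ((2 * p + ρ + 2 * q + κ : ℕ) : ℤ) * m ≤ (2 * R : ℕ) * m := by gcongr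
  have M4 : ((ρ + κ : ℕ) : ℤ) * (4 * R + 5) ≤ (2 * R : ℕ) * (4 * R + 5) := by
    gcongr; omega
  have hm' : (16 * R ^ 2 + 48 * R + 16 : ℤ) ≤ m := by exact_mod_cast hm
  push_cast at M3 M4 E1 E2
  have hm4 : (m : ℤ) - 3 ≤ 4 * (m / 4) := by omega
  have hn4 : (n : ℤ) - 3 ≤ 4 * (n / 4) := by omega
  have hn0 : (0 : ℤ) ≤ (n : ℤ) / 4 := by omega
  by_cases hρ : ρ = 0
  · by_cases hκ : κ = 0
    · subst hρ hκ
      simp only [if_true, Nat.cast_zero, mul_zero, add_zero, zero_mul] at E1 E2 B1 B2 M3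
      linarith
    -- The covers differ only in columns, so the saving is of order `n/4`, which may be small.
    -- However, replacing `n` by `m` in the cost of a column in one cover gains `(m - n)/2`;
    -- together this is at least about `m/4`.
    · have hκ1 : (0 : ℤ) ≤ (κ - 1) * (m - n) := by
        apply mul_nonneg <;> omega
      subst hρ
      simp only [if_true, if_neg hκ, Nat.cast_zero, mul_zero, add_zero, zero_mul, zero_add]
        at E1 E2 B1 B2 M3 M4
      linarith
  -- The covers differ in a row, so the part read by columns saves `m/4 - 2R`. The other part's
  -- saving term can be negative, but not below `-2R`.
  · have : (0 : ℤ) ≤ (if κ = 0 then 0 else (n : ℤ) / 4 - 2 * R) + 2 * R := by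
      split_ifs <;> omega
    rw [if_neg hρ] at E2
    linarith

end BalancedArray

/-- Sorting the cells by `cellKey` turns intervals of positions into sets of consecutive cells. -/
theorem exists_ordering_le_mul (R n m : ℕ) (hnm : n ≤ m) (hm : 16 * R ^ 2 + 48 * R + 16 ≤ m) :
    ∃ τ : Fin (n * m) ≃ Fin n × Fin m, ∀ Y : Fin (n * m) → ℤ, (∀ k, |Y k| ≤ 1) →
      (∀ J : Finset (Fin (n * m)), (J : Set (Fin (n * m))).OrdConnected → |∑ k ∈ J, Y k| ≤ 1) →
      ∀ (Rp Rm : Finset (Fin n)) (Kp Km : Finset (Fin m)),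
        (∀ i j, Y (τ.symm (i, j)) = 1 → i ∈ Rp ∨ j ∈ Kp) →
        (∀ i j, Y (τ.symm (i, j)) = -1 → i ∈ Rm ∨ j ∈ Km) →
        Rp.card + Kp.card ≤ R → Rm.card + Km.card ≤ R → ∑ k, |Y k| ≤ m * R := by
  set key : Fin n × Fin m → ℕ ×ₗ ℕ ×ₗ ℤ :=
    fun c => cellKey (2 * (n / 4)) (2 * (m / 4)) (c.1.val, c.2.val) with hkey
  have hinj : Function.Injective key := by
    intro c c' h
    have := cellKey_injective _ _ h
    simp only [Prod.mk.injEq] at this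
    exact Prod.ext (Fin.ext this.1) (Fin.ext this.2)
  set K := (Finset.univ : Finset (Fin n × Fin m)).map ⟨key, hinj⟩ with hK
  have hKcard : K.card = n * m := by simp [hK]
  let e : Fin (n * m) ≃o K := K.orderIsoOfFin hKcard
  let κ : Fin n × Fin m ≃ K := Equiv.ofBijective (fun c => ⟨key c, by simp [hK]⟩) (by
    constructor
    · intro c c' h
      exact hinj (Subtype.ext_iff.1 h)
    · rintro ⟨x, hx⟩
      obtain ⟨c, -, rfl⟩ := Finset.mem_map.1 hx
      exact ⟨c, rfl⟩)
  refine ⟨e.toEquiv.trans κ.symm, fun Y hY1 hYJ Rp Rm Kp Km hp hn hcp hcm => ?_⟩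
  set τ := e.toEquiv.trans κ.symm with hτ
  have hle : ∀ k l, key (τ k) ≤ key (τ l) ↔ k ≤ l := by
    intro k l
    have : ∀ k, key (τ k) = e k := fun k => congrArg Subtype.val (κ.apply_symm_apply (e k))
    rw [this, this, Subtype.coe_le_coe, e.le_iff_le]
  set Z : ℕ → ℕ → ℤ := fun i j =>
    if h : i < n ∧ j < m then Y (τ.symm (⟨i, h.1⟩, ⟨j, h.2⟩)) else 0 with hZ
  have hZτ : ∀ k, Z (τ k).1 (τ k).2 = Y k := by
    intro k
    simp [hZ]
  have hbal : BalancedArray n m (2 * (n / 4)) (2 * (m / 4)) Z := by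
    intro J hJ hconv
    have h1 : ∑ c ∈ J, Z c.1 c.2 =
        ∑ k with ((τ k).1.val, (τ k).2.val) ∈ J, Y k := by
      refine (Finset.sum_bij (fun k _ => ((τ k).1.val, (τ k).2.val)) ?_ ?_ ?_ ?_).symm
      · intro k hk
        exact (Finset.mem_filter.1 hk).2
      · intro k _ l _ h
        simp only [Prod.mk.injEq] at h
        exact τ.injective (Prod.ext (Fin.ext h.1) (Fin.ext h.2))
      · rintro ⟨i, j⟩ hc
        obtain ⟨hi, hj⟩ := hJ _ hc
        exact ⟨τ.symm (⟨i, hi⟩, ⟨j, hj⟩), by simpa using hc, by simp⟩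
      · intro k _
        exact (hZτ k).symm
    rw [h1]
    refine hYJ _ ⟨?_⟩
    intro k hk l hl x hx
    simp only [Finset.coe_filter, Finset.mem_univ, true_and, Set.mem_ofPred_eq] at hk hl ⊢
    exact hconv _ hk _ hl _ (τ x).1.2 _ (τ x).2.2 ((hle k x).2 hx.1) ((hle x l).2 hx.2)
  have hsum : ∑ k, |Y k| = ∑ i ∈ Finset.range n, ∑ j ∈ Finset.range m, |Z i j| := by
    rw [Finset.sum_range, ← Equiv.sum_comp τ.symm, Fintype.sum_prod_type]
    refine Finset.sum_congr rfl fun i _ => ?_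
    rw [Finset.sum_range]
    refine Finset.sum_congr rfl fun j _ => ?_
    simp [hZ]
  have hcov : ∀ (ε : ℤ) (A : Finset (Fin n)) (B : Finset (Fin m)), ε ≠ 0 →
      (∀ i j, Y (τ.symm (i, j)) = ε → i ∈ A ∨ j ∈ B) → ∀ i j, Z i j = ε →
      i ∈ A.map Fin.valEmbedding ∨ j ∈ B.map Fin.valEmbedding := by
    intro ε A B hε h i j hij
    simp only [hZ] at hij
    split_ifs at hij with hlt
    · exact (h _ _ hij).imp (fun h => Finset.mem_map.2 ⟨_, h, rfl⟩)
        fun h => Finset.mem_map.2 ⟨_, h, rfl⟩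
    · exact absurd hij.symm hε
  have hsub : ∀ {a : ℕ} (A : Finset (Fin a)), A.map Fin.valEmbedding ⊆ Finset.range a := by
    intro a A x hx
    obtain ⟨y, -, rfl⟩ := Finset.mem_map.1 hx
    exact Finset.mem_range.2 y.2
  rw [hsum]
  refine hbal.sum_abs_le R hnm hm ?_ _ _ _ _ (hcov 1 Rp Kp one_ne_zero hp)
    (hcov (-1) Rm Km (by simp) hn) (hsub _) (hsub _) (hsub _) (hsub _)
    (by simpa using hcp) (by simpa using hcm)
  intro i j
  simp only [hZ]
  split_ifs
  · exact hY1 _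
  · simp

/-! ### The permutation graph. -/

/-- The edges of `K_{m,n}` as pairs of a vertex on the second and one on the first side. -/
noncomputable def bipartiteEdgeEquiv (m n : ℕ) :
    Fin n × Fin m ≃ (completeBipartiteGraph (Fin m) (Fin n)).edgeSet :=
  Equiv.ofBijective (fun c => ⟨s(Sum.inl c.2, Sum.inr c.1), by simp⟩) (by
    constructor
    · rintro ⟨i, j⟩ ⟨i', j'⟩ h
      simp only [Subtype.mk.injEq, Sym2.eq_iff] at h
      simp_all
    · rintro ⟨e, he⟩
      induction e using Sym2.ind with
      | _ u v =>
        rcases u with j | i <;> rcases v with j' | i'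
        · simp at he
        · exact ⟨(i', j), rfl⟩
        · exact ⟨(i, j'), Subtype.ext Sym2.eq_swap⟩
        · simp at he)

/-- The hypergraph on the edges of `G` the hyperedges of which are the edge sets of the subgraphs
of `G` isomorphic to `F`. -/
def copyHypergraph {V W : Type*} (G : SimpleGraph V) (F : SimpleGraph W) :
    Hypergraph (Sym2 V) where
  vertexSet := G.edgeSet
  edgeSet := Set.range fun A : {A : G.Subgraph // Nonempty (A.coe ≃g F)} => A.1.edgeSet
  subset_vertexSet_of_mem_edgeSet' := by
    rintro _ ⟨A, rfl⟩
    exact A.1.edgeSet_subset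

theorem edgeSet_nonempty_of_iso {V W : Type*} {G : SimpleGraph V} {F : SimpleGraph W}
    {A : G.Subgraph} (φ : A.coe ≃g F) {x y : W} (h : F.Adj x y) : A.edgeSet.Nonempty :=
  ⟨s((φ.symm x : V), (φ.symm y : V)), φ.symm.map_rel_iff.2 h⟩

/-- Passing to edge sets preserves and reflects edge-disjointness. An edge of `F` keeps adjacent
copies from having the same edge set. -/
theorem homEquivalent_copyHypergraph {V W : Type*} (G : SimpleGraph V) (F : SimpleGraph W)
    {x y : W} (h : F.Adj x y) :
    HomEquivalent (kneserGraph (copyHypergraph G F)) (subgraphKneserGraph G F) := by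
  have hc : ∀ e : (copyHypergraph G F).edgeSet,
      ∃ A : {A : G.Subgraph // Nonempty (A.coe ≃g F)}, A.1.edgeSet = e := fun e => e.2
  choose c hc using hc
  refine ⟨⟨⟨c, fun {e f} hef => ⟨fun h => hef.1 (Subtype.ext ?_), ?_⟩⟩⟩,
    ⟨⟨fun A => ⟨A.1.edgeSet, A, rfl⟩, fun {A B} hAB => ⟨fun h' => ?_, hAB.2⟩⟩⟩⟩
  · rw [← hc e, ← hc f, h]
  · rw [hc e, hc f]; exact hef.2
  · obtain ⟨φ⟩ := A.2
    have hd := hAB.2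
    have hE : A.1.edgeSet = B.1.edgeSet := congrArg Subtype.val h'
    rw [← hE, disjoint_self] at hd
    exact (edgeSet_nonempty_of_iso φ h).ne_empty hd

theorem empty_notMem_edgeSet_copyHypergraph {V W : Type*} (G : SimpleGraph V)
    (F : SimpleGraph W) {x y : W} (h : F.Adj x y) : ∅ ∉ (copyHypergraph G F).edgeSet := by
  rintro ⟨A, hA⟩
  obtain ⟨φ⟩ := A.2
  exact (edgeSet_nonempty_of_iso φ h).ne_empty hA

theorem exists_subgraph_of_matching {m n r : ℕ} {f : Fin r → Fin n} {g : Fin r → Fin m}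
    (hf : Function.Injective f) (hg : Function.Injective g) :
    ∃ A : (completeBipartiteGraph (Fin m) (Fin n)).Subgraph, Nonempty (A.coe ≃g copiesK2 r) ∧
      ∀ e ∈ A.edgeSet, ∃ k, e = s(Sum.inl (g k), Sum.inr (f k)) := by
  let φ : SimpleGraph.Copy (copiesK2 r) (completeBipartiteGraph (Fin m) (Fin n)) :=
    ⟨⟨fun x => if x.2 = 0 then Sum.inl (g x.1) else Sum.inr (f x.1), by
      rintro ⟨k, a⟩ ⟨l, b⟩ ⟨_, h⟩
      have h : a ≠ b := h
      fin_cases a <;> fin_cases b <;> simp_all⟩, by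
      rintro ⟨k, a⟩ ⟨l, b⟩ h
      fin_cases a <;> fin_cases b <;> simp_all [hf.eq_iff, hg.eq_iff]⟩
  refine ⟨φ.toSubgraph, ⟨φ.isoToSubgraph.symm⟩, fun e => ?_⟩
  induction e using Sym2.ind with
  | _ u v =>
    rintro ⟨⟨k, a⟩, ⟨l, b⟩, ⟨hkl, hab⟩, rfl, rfl⟩
    obtain rfl : k = l := hkl
    have hab : a ≠ b := hab
    refine ⟨k, ?_⟩
    fin_cases a <;> fin_cases b
    · exact absurd rfl hab
    · rfl
    · exact Sym2.eq_swap
    · exact absurd rfl hab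

theorem exists_altOrder_le {r m n : ℕ} (hr : 0 < r) (hnm : n ≤ m)
    (hm : 16 * (r - 1) ^ 2 + 48 * (r - 1) + 16 ≤ m) :
    ∃ σ : Fin (n * m) ≃
        (copyHypergraph (completeBipartiteGraph (Fin m) (Fin n)) (copiesK2 r)).vertexSet,
      altOrder (copyHypergraph (completeBipartiteGraph (Fin m) (Fin n)) (copiesK2 r)) σ ≤
        m * (r - 1) := by
  obtain ⟨τ, hτ⟩ := exists_ordering_le_mul (r - 1) n m hnm hm
  refine ⟨τ.trans (bipartiteEdgeEquiv m n), csSup_le' ?_⟩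
  rintro _ ⟨X, hX, rfl⟩
  obtain ⟨Y, hYX, hYsum, hYJ⟩ := exists_balanced X
  have hcast : ∀ s : SignType, |(s : ℤ)| ≤ 1 ∧ ((s : ℤ) = 1 → s = 1) ∧ ((s : ℤ) = -1 → s = -1) := by
    decide
  have hcover : ∀ s : SignType,
      (∀ e ∈ (copyHypergraph (completeBipartiteGraph (Fin m) (Fin n)) (copiesK2 r)).edgeSet,
        ¬ e ⊆ signClass (copyHypergraph (completeBipartiteGraph (Fin m) (Fin n)) (copiesK2 r))
          (τ.trans (bipartiteEdgeEquiv m n)) X s) →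
      ∃ (P : Finset (Fin n)) (Q : Finset (Fin m)),
        (∀ i j, X (τ.symm (i, j)) = s → i ∈ P ∨ j ∈ Q) ∧ P.card + Q.card < r := by
    intro s h
    -- A matching of size `r` among the cells of sign `s` would be a copy of `rK₂` inside a sign
    -- class.
    refine exists_cover_of_no_matching (fun i j => X (τ.symm (i, j)) = s) r fun f g hf hg => ?_
    by_contra! hcon
    obtain ⟨A, hA, hAe⟩ := exists_subgraph_of_matching hf hg
    refine h A.edgeSet ⟨⟨A, hA⟩, rfl⟩ fun e he => ?_
    obtain ⟨k, rfl⟩ := hAe e he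
    have hk : (bipartiteEdgeEquiv m n (τ (τ.symm (f k, g k))) : Sym2 (Fin m ⊕ Fin n)) =
        s(Sum.inl (g k), Sum.inr (f k)) := by
      rw [τ.apply_symm_apply]
      rfl
    exact ⟨τ.symm (f k, g k), hcon k, hk⟩
  obtain ⟨Rp, Kp, hp, hcp⟩ := hcover 1 fun e he => (hX e he).1
  obtain ⟨Rm, Km, hn, hcm⟩ := hcover (-1) fun e he => (hX e he).2
  have hY : ∀ k, |Y k| ≤ 1 ∧ (Y k = 1 → X k = 1) ∧ (Y k = -1 → X k = -1) := by
    intro k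
    rcases hYX k with h | h
    · simp [h]
    · rw [h]; exact hcast _
  have := hτ Y (fun k => (hY k).1) hYJ Rp Rm Kp Km (fun i j h => hp i j ((hY _).2.1 h))
    (fun i j h => hn i j ((hY _).2.2 h)) (by omega) (by omega)
  rw [hYsum] at this
  exact_mod_cast this

/-- The `r` components have distinct ends on the second side, and only `r - 1` vertices there have
index below `r - 1`. -/
theorem exists_edge_ge_of_iso {m n r : ℕ} (hr : 0 < r)
    {A : (completeBipartiteGraph (Fin m) (Fin n)).Subgraph} (φ : A.coe ≃g copiesK2 r) :
    ∃ (j : Fin m) (i : Fin n), r - 1 ≤ i.val ∧ s(Sum.inl j, Sum.inr i) ∈ A.edgeSet := by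
  have key : ∀ k : Fin r, ∃ (x : Fin 2) (j : Fin m) (i : Fin n),
      (φ.symm (k, x) : Fin m ⊕ Fin n) = Sum.inr i ∧ s(Sum.inl j, Sum.inr i) ∈ A.edgeSet := by
    intro k
    have hadj : A.Adj (φ.symm (k, 0)) (φ.symm (k, 1)) :=
      φ.symm.map_rel_iff.2 (show (copiesK2 r).Adj (k, 0) (k, 1) from ⟨rfl, by simp⟩)
    have hG := hadj.adj_sub
    rcases h0 : (φ.symm (k, 0) : Fin m ⊕ Fin n) with j | i <;>
      rcases h1 : (φ.symm (k, 1) : Fin m ⊕ Fin n) with j' | i' <;> rw [h0, h1] at hadj hG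
    · simp at hG
    · exact ⟨1, j, i', h1, hadj⟩
    · exact ⟨0, j', i, h0, hadj.symm⟩
    · simp at hG
  choose x j i hi hmem using key
  by_contra! hcon
  have hlt : ∀ k, (i k : ℕ) < r - 1 := fun k => by
    by_contra h
    exact hcon (j k) (i k) (not_lt.1 h) (hmem k)
  have hinj : Function.Injective fun k : Fin r => (⟨i k, hlt k⟩ : Fin (r - 1)) := by
    intro k l hkl
    have hkl : i k = i l := Fin.ext (Fin.mk.inj_iff.1 hkl)
    have h : φ.symm (k, x k) = φ.symm (l, x l) := Subtype.ext (by rw [hi, hi, hkl])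
    exact (Prod.mk.inj (φ.symm.injective h)).1
  have := Fintype.card_le_of_injective _ hinj
  simp only [Fintype.card_fin] at this
  omega

theorem chromaticNumber_subgraphKneserGraph_le {m n r : ℕ} (hr : 0 < r) (hrn : r ≤ n) :
    (subgraphKneserGraph (completeBipartiteGraph (Fin m) (Fin n)) (copiesK2 r)).chromaticNumber ≤
      ((m * (n - r + 1) : ℕ) : ℕ∞) := by
  have h : ∀ A : {A : (completeBipartiteGraph (Fin m) (Fin n)).Subgraph //
      Nonempty (A.coe ≃g copiesK2 r)}, ∃ (j : Fin m) (i : Fin n), r - 1 ≤ i.val ∧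
        s(Sum.inl j, Sum.inr i) ∈ A.1.edgeSet := fun A => exists_edge_ge_of_iso hr A.2.some
  choose j i hi hmem using h
  let C : (subgraphKneserGraph (completeBipartiteGraph (Fin m) (Fin n)) (copiesK2 r)).Coloring
      (Fin m × Fin (n - r + 1)) :=
    SimpleGraph.Coloring.mk (fun A => (j A, ⟨i A - (r - 1), by have := (i A).2; omega⟩)) (by
      intro A B hAB h
      simp only [Prod.mk.injEq, Fin.mk.injEq] at h
      have h1 : i A = i B := Fin.ext (by have := hi A; have := hi B; omega)
      have h2 := hmem B
      rw [← h.1, ← h1] at h2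
      exact Set.disjoint_left.1 hAB.2 (hmem A) h2)
  have := C.colorable.chromaticNumber_le
  simpa using this

theorem mainTheorem2 (r : ℕ) (hr : 0 < r) :
    ∃ m₀ : ℕ, ∀ m n : ℕ, m₀ ≤ m → n ≤ m → r ≤ n →
      (subgraphKneserGraph (completeBipartiteGraph (Fin m) (Fin n))
          (copiesK2 r)).chromaticNumber = ((m * (n - r + 1) : ℕ) : ℕ∞) ∧
      altermaticNumber (subgraphKneserGraph (completeBipartiteGraph (Fin m) (Fin n))
          (copiesK2 r)) = ((m * (n - r + 1) : ℕ) : ℕ∞) := by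
  -- This is the bound on `m` needed in `BalancedArray.sum_abs_le`, with `R = r - 1`.
  refine ⟨16 * (r - 1) ^ 2 + 48 * (r - 1) + 16, fun m n hm hnm hrn => ?_⟩
  have hadj : (copiesK2 r).Adj (⟨0, hr⟩, 0) (⟨0, hr⟩, 1) := ⟨rfl, by simp⟩
  have h1 := chromaticNumber_subgraphKneserGraph_le (m := m) hr hrn
  have h2 := altermaticNumber_le_chromaticNumber
    (subgraphKneserGraph (completeBipartiteGraph (Fin m) (Fin n)) (copiesK2 r))
  have h3 : ((m * (n - r + 1) : ℕ) : ℕ∞) ≤ altermaticNumber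
      (subgraphKneserGraph (completeBipartiteGraph (Fin m) (Fin n)) (copiesK2 r)) := by
    obtain ⟨σ, hσ⟩ := exists_altOrder_le hr hnm hm
    refine le_trans (Nat.cast_le.2 ?_) (le_altermaticNumber (Set.toFinite _)
      (empty_notMem_edgeSet_copyHypergraph _ _ hadj) (homEquivalent_copyHypergraph _ _ hadj)
      (by rw [← Nat.card_coe_set_eq, ← Nat.card_congr σ, Nat.card_fin]) σ)
    have : m * (n - r + 1) = n * m - m * (r - 1) := by
      rw [mul_comm n m, ← Nat.mul_sub]
      congr 1
      omega
    omega
  exact ⟨le_antisymm h1 (h3.trans h2), le_antisymm (h2.trans h1) h3⟩
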